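/- **Setting.** Let $f:\mathbb R^n\to\mathbb R$, $c:\mathbb R^n\to\mathbb R^m$, and consider $\min f(x)$ subject to $c(x)=0$. Write $\|\cdot\|$ for the Euclidean (spectral) norm, $\|\cdot\|_1$ for the $\ell_1$-norm, $A(x)\in\mathbb R^{m\times n}$ for the Jacobian of $c$, $\mathcal L(x,\lambda)=f(x)+\lambda^\top c(x)$, $\varphi(x,\mu)=f(x)+\mu\|c(x)\|_1$, and, for given $x_k,\lambda_k$, put $c_k=c(x_k)$, $g_k=\nabla f(x_k)$, $A_k=A(x_k)$, $H_k=\nabla^2f(x_k)+\sum_i\lambda_k^i\nabla^2c^i(x_k)$, and let $P_k$ be the orthogonal projection onto $\mathcal N(A_k)$. **Algorithm (SCP).** Constants: $\sigma_0\ge\sigma_{\min}>0$, $\mu_{-1}>0$, $0<\eta_1<\eta_2<1$, $\nu>1$, $\tau\in(0,1)$, $\theta\in(0,1]$, $\zeta\in(0,\theta)$, $\gamma_2>\gamma_1>1$, $\gamma_3\in(0,1]$, $\delta\in(0,1/6)$, $r_v\in[0,1-\tau)$, $r_\lambda,r_w\ge0$. From $x_0\in\mathbb R^n$, for $k=0,1,2,\dots$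 (the stopping test is not applied): 1. *Normal step:* $v_k=\beta_kv_k^c$ with $v_k^c\in\mathcal R(A_k^\top)$ and $\|A_kv_k^c+c_k\|_1\le r_v\min\{\|c_k\|_1,\|v_k^c\|^3\}$; $v_k^c=0$ if $c_k=0$; and if $c_k\ne0$ then $\beta_k\in\big[\min\{1,\tfrac{\theta}{\|v_k^c\|\sqrt{\sigma_k}}\},\min\{1,\tfrac{1}{\|v_k^c\|\sqrt{\sigma_k}}\}\big]$. 2. *Multipliers:* $\|A_k(g_k+A_k^\top\lambda_k)\|\le r_\lambda\|v_k\|$. 3. *Tangential step:* with $\widetilde g_k=P_k^\top(g_k+H_kv_k)$, $\widetilde H_k=P_k^\top H_kP_k$ and $m_k^U(u)=f(x_k)+\widetilde g_k^\top u+\tfrac12u^\top\widetilde H_ku+\tfrac{\sigma_k}3\|P_ku\|^3$, the vector $u_k\in\mathcal R(P_k)$ satisfies (OR1) $m_k^U(u_k)\le m_k^U(-\alpha_k^*\widetilde g_k)$ for a minimizer $\alpha_k^*$ of $\alpha\mapsto m_k^U(-\alpha\widetilde g_k)$ over $\alpha\ge0$; (OR2) $\|\nabla m_k^U(u_k)\|\le\delta\sigma_k\|u_k\|^2$;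 (OR3) $\lambda_{\min}(\widetilde H_k)\ge-\sigma_k\|u_k\|$. Put $d_k=v_k+u_k$. 4. *Merit parameter:* $\mu_k=\nu\mu_k^c$ if $\mu_{k-1}<\mu_k^c$ and $\mu_k=\mu_{k-1}$ otherwise, where $\mu_k^c=0$ if $c_k=0$ and otherwise $\mu_k^c=\dfrac{g_k^\top v_k+\frac12v_k^\top H_kv_k+\frac{\sigma_k}3(\|d_k\|^3-\|u_k\|^3)}{(1-r_v-\tau)\beta_k\|c_k\|_1}$. 5. *Acceptance:* let $q_k(d)=f(x_k)+g_k^\top d+\tfrac12d^\top H_kd+\tfrac{\sigma_k}3\|d\|^3+\mu_k\|c_k+A_kd\|_1$, $\Delta q_k=q_k(0)-q_k(d_k)$ and $\rho_k=\dfrac{\varphi(x_k,\mu_k)-\varphi(x_k+d_k,\mu_k)}{\Delta q_k}$ (ratios are read as $0$ if $\Delta q_k=0$). If $\rho_k\ge\eta_1$, set $x_{k+1}=x_k+d_k$. Otherwise, if $\|v_k^c\|\le\zeta/\sqrt{\sigma_k}$, compute a correction $w_k\in\mathcal R(A_k^\top)$ with $\|A_kw_k+c(x_k+d_k)\|\le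 r_w\|d_k\|^3$ and, if $\rho_k^{corr}=\dfrac{\varphi(x_k,\mu_k)-\varphi(x_k+d_k+w_k,\mu_k)}{\Delta q_k}\ge\eta_1$, set $x_{k+1}=x_k+d_k+w_k$. In all other cases set $x_{k+1}=x_k$. Iteration $k$ is *successful* if one of the two steps was accepted, and *very successful* if in addition the ratio that led to acceptance exceeds $\eta_2$. 6. *Regularization:* $\sigma_{k+1}\in[\max\{\sigma_{\min},\gamma_3\sigma_k\},\sigma_k]$ if $k$ is very successful, $\sigma_{k+1}=\sigma_k$ if $k$ is successful but not very successful, and $\sigma_{k+1}\in[\gamma_1\sigma_k,\gamma_2\sigma_k]$ otherwise. **Assumptions.** Let $\mathcal X\subseteq\mathbb R^n$ be an open convex set that contains all iterates $x_k$, all trial points $x_k+d_k$, and all corrected trial points $x_k+d_k+w_k$ for those $k$ at which a correction is computed. Suppose: * (F1) $f$ and $c$ are $C^2$ on $\mathcal X$, and $f,\nabla f,c_i,\nabla c_i$ ($i\le m$) are bounded and Lipschitz continuous on $\mathcal X$; * (F2) there is $\gamma_A>0$ with $\sigma_{\min}(A(x))\ge\gamma_A$ for all $x\in\mathcal X$,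 where $\sigma_{\min}(A)$ is the square root of the smallest eigenvalue of $AA^\top$ (so $A(x)$ has full row rank); * (F3) $\|H_k\|\le\kappa_H$ for all $k$, for some $\kappa_H>0$; * (F4) $f(x_k)\ge f_{low}$ for all successful $k$, for some $f_{low}\in\mathbb R$; * (F5) $\nabla^2f$ and $\nabla^2c_i$ ($i\le m$) are bounded and Lipschitz continuous on $\mathcal X$. **Theorem.** For each $k$ let the columns of $Z_k\in\mathbb R^{n\times(n-m)}$ be an orthonormal basis of $\mathcal N(A_k)$. Then $$\lim_{k\to\infty}\|\nabla_x\mathcal L(x_k,\lambda_k)\|=0,\qquad\lim_{k\to\infty}\|c_k\|_1=0,\qquad\liminf_{k\to\infty}\lambda_{\min}(Z_k^\top H_kZ_k)\ge0,$$ where $\lambda_{\min}$ denotes the smallest eigenvalue ($+\infty$ for the empty matrix). Consequently, at every limit point $\bar x$ of $(x_k)$ at which $f$ and $c$ are twice continuously differentiable (in particular, every limit point in $\mathcal X$), there is $\bar\lambda\in\mathbb R^m$ with $\nabla_x\mathcal L(\bar x,\bar\lambda)=0$, $c(\bar x)=0$, and $d^\top\nabla^2_{xx}\mathcal L(\bar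 x,\bar\lambda)d\ge0$ for all $d$ with $A(\bar x)d=0$. -/

import Mathlib

open Filter Topology Set
open scoped Gradient NNReal RealInnerProductSpace

noncomputable section

/-- Euclidean space `ℝⁿ` with the `ℓ²` norm. -/
abbrev Euc (n : ℕ) : Type := EuclideanSpace ℝ (Fin n)

namespace SCP

variable {n m : ℕ}

/-! ### Linear algebra -/

/-- The `ℓ¹` norm of a vector. -/
def l1 (y : Euc m) : ℝ := ∑ i, |y i|

/-- The minimum eigenvalue of a (symmetric) operator on `ℝᵖ`. It is a real number when `p ≥ 1`; the
operator on the zero space has no eigenvalue and gets the value `⊤`. -/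
def lambdaMin {p : ℕ} (T : Euc p →L[ℝ] Euc p) : EReal :=
  ⨅ (t : ℝ) (_ : Module.End.HasEigenvalue (T : Euc p →ₗ[ℝ] Euc p) t), (t : EReal)

/-- The smallest of the `m` singular values of an `m × n` matrix `A`, the square roots of
the `m` eigenvalues of `A Aᵀ`. It is positive exactly when `A` has full row rank. -/
def sigmaMin (A : Euc n →L[ℝ] Euc m) : EReal :=
  ⨅ (t : ℝ) (_ : Module.End.HasEigenvalue
      ((A ∘L ContinuousLinearMap.adjoint A : Euc m →L[ℝ] Euc m) : Euc m →ₗ[ℝ] Euc m) t),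
    ((√t : ℝ) : EReal)

/-- The orthogonal projection of `ℝⁿ` onto the null space of `A`. -/
def nullProj (A : Euc n →L[ℝ] Euc m) : Euc n →L[ℝ] Euc n :=
  (LinearMap.ker (A : Euc n →ₗ[ℝ] Euc m)).starProjection

/-! ### The problem `min f(x)` subject to `c(x) = 0` -/

/-- The Hessian of a real function, as the derivative of its gradient. -/
def hess (h : Euc n → ℝ) (x : Euc n) : Euc n →L[ℝ] Euc n := fderiv ℝ (∇ h) x

/-- The `i`-th constraint function. -/
def con (c : Euc n → Euc m) (i : Fin m) : Euc n → ℝ := fun x => c x i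

/-- The Jacobian `A(x)` of the constraints. -/
def jac (c : Euc n → Euc m) (x : Euc n) : Euc n →L[ℝ] Euc m := fderiv ℝ c x

/-- The Lagrangian `L(x, lam) = f(x) + lamᵀ c(x)`. -/
def lagrangian (f : Euc n → ℝ) (c : Euc n → Euc m) (x : Euc n) (lam : Euc m) : ℝ :=
  f x + ⟪lam, c x⟫

/-- The gradient of the Lagrangian in `x`. -/
def gradLagrangian (f : Euc n → ℝ) (c : Euc n → Euc m) (x : Euc n) (lam : Euc m) : Euc n :=
  gradient (fun y => lagrangian f c y lam) x

/-- The Hessian of the Lagrangian, `∇²f(x) + ∑ᵢ lamᵢ ∇²cᵢ(x)`. -/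
def hessLagrangian (f : Euc n → ℝ) (c : Euc n → Euc m) (x : Euc n) (lam : Euc m) :
    Euc n →L[ℝ] Euc n :=
  hess f x + ∑ i, lam i • hess (con c i) x

/-- `x` is an `(εg, εc, εH)`-second-order stationary point. -/
def IsSOSP (f : Euc n → ℝ) (c : Euc n → Euc m) (εg εc εH : ℝ) (x : Euc n) : Prop :=
  ∃ lam : Euc m, ‖gradLagrangian f c x lam‖ ≤ εg ∧ l1 (c x) ≤ εc ∧
    ∀ d : Euc n, jac c x d = 0 → -εH * ‖d‖ ^ 2 ≤ ⟪d, hessLagrangian f c x lam d⟫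

/-- The `ℓ¹` merit function. -/
def merit (f : Euc n → ℝ) (c : Euc n → Euc m) (x : Euc n) (mu : ℝ) : ℝ :=
  f x + mu * l1 (c x)

/-! ### The algorithm -/

/-- The user-chosen constants of the algorithm. -/
structure Params where
  (sigmaMin muInit eta₁ eta₂ nu tau theta zeta gam₁ gam₂ gam₃ delta rv rlam rw : ℝ)
  sigmaMin_pos : 0 < sigmaMin
  muInit_pos : 0 < muInit
  eta₁_pos : 0 < eta₁
  eta₁_lt_eta₂ : eta₁ < eta₂
  eta₂_lt_one : eta₂ < 1
  one_lt_nu : 1 < nu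
  tau_mem : tau ∈ Ioo (0 : ℝ) 1
  theta_mem : theta ∈ Ioc (0 : ℝ) 1
  zeta_mem : zeta ∈ Ioo 0 theta
  one_lt_gam₁ : 1 < gam₁
  gam₁_lt_gam₂ : gam₁ < gam₂
  gam₃_mem : gam₃ ∈ Ioc (0 : ℝ) 1
  delta_mem : delta ∈ Ioo (0 : ℝ) (1 / 6)
  rv_mem : rv ∈ Ico 0 (1 - tau)
  rlam_nonneg : 0 ≤ rlam
  rw_nonneg : 0 ≤ rw

/-- The sequences that the algorithm generates: iterates `x`, regularization parameters `sig`,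
merit parameters `mu` (`mu k` is the value after the update in iteration `k`), multipliers `lam`,
unscaled normal steps `vc`, feasibility parameters `bet`, tangential steps `u`, and second-order
corrections `w` (the value `w k` matters only if a correction is computed in iteration `k`). -/
structure Iterates (n m : ℕ) where
  (x : ℕ → Euc n)
  (sig mu : ℕ → ℝ)
  (lam : ℕ → Euc m)
  (vc : ℕ → Euc n)
  (bet : ℕ → ℝ)
  (u w : ℕ → Euc n)

namespace Iterates

variable (p : Params) (f : Euc n → ℝ) (c : Euc n → Euc m) (s : Iterates n m) (k : ℕ)

/-- `g_k`, the gradient of the objective. -/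
def g : Euc n := ∇ f (s.x k)

/-- `A_k`, the Jacobian of the constraints. -/
def A : Euc n →L[ℝ] Euc m := jac c (s.x k)

/-- `H_k`, the Hessian of the Lagrangian at `(x_k, lam_k)`. -/
def H : Euc n →L[ℝ] Euc n := hessLagrangian f c (s.x k) (s.lam k)

/-- `P_k`, the orthogonal projection onto the null space of `A_k`. -/
def P : Euc n →L[ℝ] Euc n := nullProj (s.A c k)

/-- The normal step `v_k`. -/
def v : Euc n := s.bet k • s.vc k

/-- The trial step `d_k = v_k + u_k`. -/
def d : Euc n := s.v k + s.u k

/-- `P_kᵀ (g_k + H_k v_k)`. -/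
def gTilde : Euc n := ContinuousLinearMap.adjoint (s.P c k) (s.g f k + s.H f c k (s.v k))

/-- `P_kᵀ H_k P_k`. -/
def HTilde : Euc n →L[ℝ] Euc n :=
  ContinuousLinearMap.adjoint (s.P c k) ∘L s.H f c k ∘L s.P c k

/-- The reduced cubic model `m_k^U`. -/
def mU (y : Euc n) : ℝ :=
  f (s.x k) + ⟪s.gTilde f c k, y⟫ + 1 / 2 * ⟪y, s.HTilde f c k y⟫
    + s.sig k / 3 * ‖s.P c k y‖ ^ 3

/-- The predicted reduction of the reduced model. -/
def deltaM (y : Euc n) : ℝ := s.mU f c k 0 - s.mU f c k y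

/-- The conditions on the tangential step returned by the oracle: it lies in the range of `P_k`,
it does at least as well as the Cauchy point, the gradient of the reduced model at it is of order
`‖u_k‖²`, and the negative curvature of `P_kᵀ H_k P_k` is at most `σ_k ‖u_k‖`. -/
structure Oracle : Prop where
  mem_range : s.u k ∈ LinearMap.range (s.P c k : Euc n →ₗ[ℝ] Euc n)
  or1 : ∃ α : ℝ, 0 ≤ α ∧ IsMinOn (fun a : ℝ => s.mU f c k (-(a • s.gTilde f c k))) (Ici 0) α ∧
    s.deltaM f c k (-(α • s.gTilde f c k)) ≤ s.deltaM f c k (s.u k)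
  or2 : ‖∇ (s.mU f c k) (s.u k)‖ ≤ p.delta * s.sig k * ‖s.u k‖ ^ 2
  or3 : ((-(s.sig k * ‖s.u k‖) : ℝ) : EReal) ≤ lambdaMin (s.HTilde f c k)

/-- The conditions on the normal step. -/
structure NormalStep : Prop where
  mem_range : s.vc k ∈
    LinearMap.range (ContinuousLinearMap.adjoint (s.A c k) : Euc m →ₗ[ℝ] Euc n)
  resid : l1 (s.A c k (s.vc k) + c (s.x k)) ≤ p.rv * min (l1 (c (s.x k))) (‖s.vc k‖ ^ 3)
  eq_zero : c (s.x k) = 0 → s.vc k = 0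
  bet_mem : c (s.x k) ≠ 0 → s.bet k ∈
    Icc (min 1 (p.theta / (‖s.vc k‖ * √(s.sig k)))) (min 1 (1 / (‖s.vc k‖ * √(s.sig k))))

/-- The value `μ_k^c` to which the merit parameter is compared. -/
def muC : ℝ :=
  if l1 (c (s.x k)) = 0 then 0
  else (⟪s.g f k, s.v k⟫ + 1 / 2 * ⟪s.v k, s.H f c k (s.v k)⟫
      + s.sig k / 3 * (‖s.d k‖ ^ 3 - ‖s.u k‖ ^ 3))
    / ((1 - p.rv - p.tau) * s.bet k * l1 (c (s.x k)))

/-- The merit parameter before the update of iteration `k`. -/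
def muPrev : ℕ → ℝ
  | 0 => p.muInit
  | k + 1 => s.mu k

/-- The cubic model `q_k` of the merit function. -/
def q (y : Euc n) : ℝ :=
  f (s.x k) + ⟪s.g f k, y⟫ + 1 / 2 * ⟪y, s.H f c k y⟫ + s.sig k / 3 * ‖y‖ ^ 3
    + s.mu k * l1 (c (s.x k) + s.A c k y)

/-- The predicted reduction of the merit function. -/
def deltaQ : ℝ := s.q f c k 0 - s.q f c k (s.d k)

/-- The ratio of actual to predicted reduction of the trial step. -/
def rho : ℝ :=
  (merit f c (s.x k) (s.mu k) - merit f c (s.x k + s.d k) (s.mu k)) / s.deltaQ f c k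

/-- The ratio of actual to predicted reduction of the corrected trial step. -/
def rhoCorr : ℝ :=
  (merit f c (s.x k) (s.mu k) - merit f c (s.x k + s.d k + s.w k) (s.mu k)) / s.deltaQ f c k

/-- Iteration `k` is nearly feasible. -/
def NearFeasible : Prop := ‖s.vc k‖ ≤ p.zeta / √(s.sig k)

/-- A second-order correction is computed in iteration `k`. -/
def Corrects : Prop := s.rho f c k < p.eta₁ ∧ s.NearFeasible p k

/-- Iteration `k` is successful (very successful iterations included). -/
def Successful : Prop :=
  p.eta₁ ≤ s.rho f c k ∨ (s.Corrects p f c k ∧ p.eta₁ ≤ s.rhoCorr f c k)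

/-- Iteration `k` is very successful. -/
def VerySuccessful : Prop :=
  p.eta₂ < s.rho f c k ∨ (s.Corrects p f c k ∧ p.eta₂ < s.rhoCorr f c k)

/-- The sequences `s` are an infinite run of the loop body of the algorithm with constants `p` on the
problem `(f, c)`; the stopping test is not applied. The predicted reduction `deltaQ` is positive
unless `x_k` is already an exact second-order stationary point; there it is zero, both ratios are
read as `0`, and the iterate stays where it is. -/
structure IsRun : Prop where
  sig_zero : p.sigmaMin ≤ s.sig 0
  normal : ∀ k, s.NormalStep p c k
  dual : ∀ k, ‖s.A c k (s.g f k + ContinuousLinearMap.adjoint (s.A c k) (s.lam k))‖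
    ≤ p.rlam * ‖s.v k‖
  tangential : ∀ k, s.Oracle p f c k
  mu_eq : ∀ k, s.mu k =
    if s.muPrev p k < s.muC p f c k then p.nu * s.muC p f c k else s.muPrev p k
  corr_mem : ∀ k, s.Corrects p f c k → s.w k ∈
    LinearMap.range (ContinuousLinearMap.adjoint (s.A c k) : Euc m →ₗ[ℝ] Euc n)
  corr_resid : ∀ k, s.Corrects p f c k →
    ‖s.A c k (s.w k) + c (s.x k + s.d k)‖ ≤ p.rw * ‖s.d k‖ ^ 3
  x_accept : ∀ k, p.eta₁ ≤ s.rho f c k → s.x (k + 1) = s.x k + s.d k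
  x_correct : ∀ k, s.Corrects p f c k → p.eta₁ ≤ s.rhoCorr f c k →
    s.x (k + 1) = s.x k + s.d k + s.w k
  x_reject : ∀ k, ¬ s.Successful p f c k → s.x (k + 1) = s.x k
  sig_very : ∀ k, s.VerySuccessful p f c k →
    s.sig (k + 1) ∈ Icc (max p.sigmaMin (p.gam₃ * s.sig k)) (s.sig k)
  sig_succ : ∀ k, s.Successful p f c k → ¬ s.VerySuccessful p f c k →
    s.sig (k + 1) = s.sig k
  sig_unsucc : ∀ k, ¬ s.Successful p f c k →
    s.sig (k + 1) ∈ Icc (p.gam₁ * s.sig k) (p.gam₂ * s.sig k)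

/-- `X` is an open convex set that contains all iterates and all trial points at which the
algorithm evaluates the merit function. -/
structure Domain (X : Set (Euc n)) : Prop where
  isOpen : IsOpen X
  convex : Convex ℝ X
  iterate_mem : ∀ k, s.x k ∈ X
  trial_mem : ∀ k, s.x k + s.d k ∈ X
  corr_mem : ∀ k, s.Corrects p f c k → s.x k + s.d k + s.w k ∈ X

/-- (F3): the Hessians of the Lagrangian used by the algorithm are bounded. -/
def F3 : Prop := ∃ κ : ℝ, 0 < κ ∧ ∀ k, ‖s.H f c k‖ ≤ κ

/-- (F4): the objective is bounded below on the successful iterates. -/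
def F4 : Prop := ∃ fLow : ℝ, ∀ k, s.Successful p f c k → fLow ≤ f (s.x k)

end Iterates

/-- `h` is bounded and Lipschitz continuous on `X`. -/
def BddLipschitzOn {E : Type*} [NormedAddCommGroup E] (h : Euc n → E) (X : Set (Euc n)) : Prop :=
  (∃ κ : ℝ, ∀ x ∈ X, ‖h x‖ ≤ κ) ∧ ∃ L : ℝ≥0, LipschitzOnWith L h X

/-- (F1): `f` and `c` are `C²` on `X`, and `f`, `∇f`, `cᵢ`, `∇cᵢ` are bounded and Lipschitz
continuous on `X`. -/
structure F1 (f : Euc n → ℝ) (c : Euc n → Euc m) (X : Set (Euc n)) : Prop where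
  f_smooth : ContDiffOn ℝ 2 f X
  c_smooth : ContDiffOn ℝ 2 c X
  f_bdd : BddLipschitzOn f X
  g_bdd : BddLipschitzOn (∇ f) X
  c_bdd : ∀ i, BddLipschitzOn (con c i) X
  gc_bdd : ∀ i, BddLipschitzOn (∇ (con c i)) X

/-- (F2): the smallest singular value of the Jacobian is bounded away from zero on `X`. -/
def F2 (c : Euc n → Euc m) (X : Set (Euc n)) : Prop :=
  ∃ γA : ℝ, 0 < γA ∧ ∀ x ∈ X, (γA : EReal) ≤ sigmaMin (jac c x)

/-- (F5): the Hessians of `f` and of the `cᵢ` are bounded and Lipschitz continuous on `X`. -/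
structure F5 (f : Euc n → ℝ) (c : Euc n → Euc m) (X : Set (Euc n)) : Prop where
  f_hess : BddLipschitzOn (hess f) X
  c_hess : ∀ i, BddLipschitzOn (hess (con c i)) X

end SCP

end

/-!
# Convergence to second-order points of a sequential cubic programming method

Write `Δq` for the predicted reduction of the merit function, `v` and `u` for the normal and the
tangential step, `d = v + u`, and `σ` for the regularization parameter.

The engine of the proof is that `Δq` controls both step components. The update of the merit
parameter makes `Δq` at least the decrease of the reduced cubic model plus a multiple of the
linearized gain in feasibility (`BoundedRun.le_deltaQ`). The second term is at least a multiple of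
`‖v‖`. The first is at least `(1/6 - δ) σ ‖u‖³`, because the two conditions on the gradient and
on the curvature of the reduced model at `u` already force this decrease (`BoundedRun.le_deltaM`). When
`σ` is bounded, small `v` and `u` in turn mean that `x_k` almost satisfies the second-order
conditions (`BoundedRun.nearStationary_of_norm_le`). So it suffices that `σ` stays bounded and that `Δq`
tends to zero along the successful iterations.

Both `σ^(1/2) ‖v‖` and `σ^(1/2) ‖u‖` are bounded, hence so is the merit parameter, which is
therefore eventually constant (`BoundedRun.exists_mu_eq`). For large `σ` an iteration with `Δq > 0` is
successful, in one of two ways. Far from feasibility, `Δq` is of order `σ^(-1/2)` and beats the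
first-order model error `O(‖d‖²) = O(σ⁻¹)`. Near feasibility the normal step is not scaled back, the
correction reduces the constraint violation to `O(‖d‖³)`, and its effect on the objective is,
through the approximate multipliers, exactly the missing constraint curvature of the Lagrangian; the error
`O(‖d‖³)` is absorbed by the cubic term (`BoundedRun.exists_f_corrected_le`,
`BoundedRun.exists_successful_of_nearFeasible`). Thus `σ` is bounded, infinitely many iterations are
successful, and the monotone, bounded merit function gives `Δq → 0` along them.

If `Δq` vanishes once, then `x_k` is exactly stationary, the multiplier is determined by `x_k`, and
the run stays there with `Δq = 0` (`BoundedRun.deltaQ_succ_eq_zero`); here `σ` is unbounded.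

An unsuccessful iteration shares its point with the next successful one but may use another
multiplier. The dual condition and the lower bound on the singular values of the Jacobian make the
two multipliers, and so the two Hessians, close (`BoundedRun.exists_nearStationary_transfer`). Limit
points are treated by passing to a subsequence along which the bounded multipliers converge.
-/

namespace SCP

variable {n m : ℕ}

/-! ### The `ℓ¹` norm -/

lemma l1_nonneg (y : Euc m) : 0 ≤ l1 y := Finset.sum_nonneg fun _ _ => abs_nonneg _

lemma l1_zero : l1 (0 : Euc m) = 0 := by simp [l1]

lemma l1_add_le (y z : Euc m) : l1 (y + z) ≤ l1 y + l1 z := by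
  unfold l1
  rw [← Finset.sum_add_distrib]
  exact Finset.sum_le_sum fun i _ => abs_add_le _ _

lemma l1_smul (a : ℝ) (y : Euc m) : l1 (a • y) = |a| * l1 y := by
  simp [l1, abs_mul, Finset.mul_sum]

lemma l1_neg (y : Euc m) : l1 (-y) = l1 y := by simp [l1]

lemma abs_inner_le_norm_mul_l1 (y z : Euc m) : |⟪y, z⟫| ≤ ‖y‖ * l1 z := by
  rw [PiLp.inner_apply, l1, Finset.mul_sum]
  refine (Finset.abs_sum_le_sum_abs _ _).trans (Finset.sum_le_sum fun i _ => ?_)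
  have := PiLp.norm_apply_le y i
  rw [Real.norm_eq_abs] at this
  simp only [RCLike.inner_apply, conj_trivial, abs_mul]
  rw [mul_comm]
  gcongr

lemma norm_le_l1 (y : Euc m) : ‖y‖ ≤ l1 y := by
  have h := abs_inner_le_norm_mul_l1 y y
  rw [real_inner_self_eq_norm_mul_norm, abs_of_nonneg (by positivity)] at h
  by_contra! hlt
  have : 0 < ‖y‖ := (l1_nonneg y).trans_lt hlt
  nlinarith

lemma l1_le_card_mul_norm (y : Euc m) : l1 y ≤ m * ‖y‖ := by
  have : ∀ i ∈ Finset.univ, |y i| ≤ ‖y‖ := fun i _ => by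
    simpa using PiLp.norm_apply_le y i
  simpa [l1] using Finset.sum_le_card_nsmul _ _ _ this

lemma l1_eq_zero_iff (y : Euc m) : l1 y = 0 ↔ y = 0 := by
  refine ⟨fun h => ?_, fun h => h ▸ l1_zero⟩
  have := norm_le_l1 y
  rw [h] at this
  simpa using this

lemma continuous_l1 : Continuous (l1 : Euc m → ℝ) := by
  unfold l1; fun_prop

/-! ### Smallest eigenvalues and singular values -/

/-- By the spectral theorem, `lambdaMin` of a symmetric operator bounds its quadratic form. -/
lemma le_inner_of_le_lambdaMin {p : ℕ} {T : Euc p →L[ℝ] Euc p}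
    (hT : (T : Euc p →ₗ[ℝ] Euc p).IsSymmetric) {a : ℝ} (ha : (a : EReal) ≤ lambdaMin T)
    (y : Euc p) : a * ‖y‖ ^ 2 ≤ ⟪y, T y⟫ := by
  rcases eq_or_ne y 0 with rfl | hy
  · simp
  have : Nontrivial (Euc p) := ⟨y, 0, hy⟩
  have hev := hT.hasEigenvalue_iInf_of_finiteDimensional
  have h1 := ha.trans (iInf₂_le _ hev)
  have hsa : IsSelfAdjoint T := (ContinuousLinearMap.isSelfAdjoint_iff_isSymmetric).2 hT
  have hbdd : BddBelow (range fun x : {x : Euc p // x ≠ 0} =>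
      RCLike.re ⟪(T : Euc p →ₗ[ℝ] Euc p) x, (x : Euc p)⟫ / ‖(x : Euc p)‖ ^ 2) := by
    refine ⟨-‖T‖, ?_⟩
    rintro _ ⟨⟨x, hx⟩, rfl⟩
    have hx' : 0 < ‖x‖ := norm_pos_iff.2 hx
    simp only [RCLike.re_to_real, ContinuousLinearMap.coe_coe]
    rw [le_div_iff₀ (by positivity)]
    have h2 := abs_le.1 (abs_real_inner_le_norm (T x) x)
    have h3 := T.le_opNorm x
    nlinarith [h2.1]
  have h2 := ciInf_le hbdd ⟨y, hy⟩
  have h3 : a ≤ _ := (EReal.coe_le_coe_iff.1 h1).trans h2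
  have hy' : 0 < ‖y‖ := norm_pos_iff.2 hy
  simp only [RCLike.re_to_real, ContinuousLinearMap.coe_coe] at h3
  rw [le_div_iff₀ (by positivity), real_inner_comm] at h3
  exact h3

lemma le_lambdaMin_of_le_inner {p : ℕ} {T : Euc p →L[ℝ] Euc p} {a : ℝ}
    (h : ∀ y, a * ‖y‖ ^ 2 ≤ ⟪y, T y⟫) : (a : EReal) ≤ lambdaMin T := by
  refine le_iInf₂ fun t ht => ?_
  obtain ⟨y, hy⟩ := ht.exists_hasEigenvector
  have h1 : T y = t • y := hy.apply_eq_smul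
  have h2 := h y
  rw [h1, inner_smul_right, real_inner_self_eq_norm_sq] at h2
  have : 0 < ‖y‖ := norm_pos_iff.2 hy.2
  exact_mod_cast le_of_mul_le_mul_right h2 (by positivity)

lemma mul_norm_le_norm_adjoint {A : Euc n →L[ℝ] Euc m} {γ : ℝ} (hγ : 0 < γ)
    (h : (γ : EReal) ≤ sigmaMin A) (z : Euc m) :
    γ * ‖z‖ ≤ ‖ContinuousLinearMap.adjoint A z‖ := by
  have hsym : ((A ∘L ContinuousLinearMap.adjoint A : Euc m →L[ℝ] Euc m) :
      Euc m →ₗ[ℝ] Euc m).IsSymmetric := by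
    intro x y
    simp only [ContinuousLinearMap.coe_coe, ContinuousLinearMap.comp_apply]
    rw [← ContinuousLinearMap.adjoint_inner_left, ← ContinuousLinearMap.adjoint_inner_right,
      ContinuousLinearMap.adjoint_inner_left]
  have hl : ((γ ^ 2 : ℝ) : EReal) ≤ lambdaMin (A ∘L ContinuousLinearMap.adjoint A) := by
    refine le_iInf₂ fun t ht => ?_
    have h1 : γ ≤ √t := EReal.coe_le_coe_iff.1 (h.trans (iInf₂_le t ht))
    have ht0 : 0 < t := Real.sqrt_pos.1 (hγ.trans_le h1)
    have : γ ^ 2 ≤ t := by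
      have := Real.sq_sqrt ht0.le
      nlinarith
    exact_mod_cast this
  have h2 := le_inner_of_le_lambdaMin hsym hl z
  rw [ContinuousLinearMap.comp_apply, ← ContinuousLinearMap.adjoint_inner_left,
    real_inner_self_eq_norm_sq, ← mul_pow] at h2
  exact le_of_sq_le_sq h2 (norm_nonneg _)

lemma mul_norm_le_norm_apply_of_mem_range {A : Euc n →L[ℝ] Euc m} {γ : ℝ} (hγ : 0 < γ)
    (h : ∀ z, γ * ‖z‖ ≤ ‖ContinuousLinearMap.adjoint A z‖) {y : Euc n}
    (hy : y ∈ LinearMap.range (ContinuousLinearMap.adjoint A : Euc m →ₗ[ℝ] Euc n)) :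
    γ * ‖y‖ ≤ ‖A y‖ := by
  obtain ⟨z, rfl⟩ := hy
  simp only [ContinuousLinearMap.coe_coe]
  set y := ContinuousLinearMap.adjoint A z with hy
  have h1 : ‖y‖ ^ 2 = ⟪z, A y⟫ := by
    rw [← ContinuousLinearMap.adjoint_inner_left, real_inner_self_eq_norm_sq]
  have h2 := real_inner_le_norm z (A y)
  have h3 := h z
  rcases (norm_nonneg y).eq_or_lt with h0 | h0
  · rw [← h0]; simp
  · have : γ * ‖y‖ ^ 2 ≤ ‖y‖ * ‖A y‖ := by
      calc γ * ‖y‖ ^ 2 ≤ γ * (‖z‖ * ‖A y‖) := by rw [h1]; gcongr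
        _ = (γ * ‖z‖) * ‖A y‖ := by ring
        _ ≤ ‖y‖ * ‖A y‖ := by gcongr
    nlinarith

/-! ### The projection onto a null space -/

lemma apply_nullProj (A : Euc n →L[ℝ] Euc m) (y : Euc n) : A (nullProj A y) = 0 :=
  LinearMap.mem_ker.1 (Submodule.starProjection_apply_mem _ y)

lemma nullProj_eq_self {A : Euc n →L[ℝ] Euc m} {y : Euc n} (hy : A y = 0) :
    nullProj A y = y :=
  Submodule.starProjection_eq_self_iff.2 (LinearMap.mem_ker.2 hy)

lemma mem_range_nullProj_iff {A : Euc n →L[ℝ] Euc m} {y : Euc n} :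
    y ∈ LinearMap.range (nullProj A : Euc n →ₗ[ℝ] Euc n) ↔ A y = 0 := by
  refine ⟨?_, fun h => ⟨y, nullProj_eq_self h⟩⟩
  rintro ⟨z, rfl⟩
  exact apply_nullProj A z

lemma adjoint_nullProj (A : Euc n →L[ℝ] Euc m) :
    ContinuousLinearMap.adjoint (nullProj A) = nullProj A :=
  (isSelfAdjoint_starProjection _).adjoint_eq

lemma inner_nullProj_left (A : Euc n →L[ℝ] Euc m) (y z : Euc n) :
    ⟪nullProj A y, z⟫ = ⟪y, nullProj A z⟫ := by
  rw [← ContinuousLinearMap.adjoint_inner_left, adjoint_nullProj]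

lemma norm_nullProj_le (A : Euc n →L[ℝ] Euc m) (y : Euc n) : ‖nullProj A y‖ ≤ ‖y‖ :=
  Submodule.norm_starProjection_apply_le _ y

lemma sub_nullProj_mem_range_adjoint (A : Euc n →L[ℝ] Euc m) (y : Euc n) :
    y - nullProj A y ∈
      LinearMap.range (ContinuousLinearMap.adjoint A : Euc m →ₗ[ℝ] Euc n) := by
  have h := LinearMap.orthogonal_ker (A : Euc n →ₗ[ℝ] Euc m)
  have h1 : y - nullProj A y ∈ (LinearMap.ker (A : Euc n →ₗ[ℝ] Euc m))ᗮ :=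
    Submodule.sub_starProjection_mem_orthogonal y
  rw [h] at h1
  exact h1

lemma nullProj_adjoint (A : Euc n →L[ℝ] Euc m) (z : Euc m) :
    nullProj A (ContinuousLinearMap.adjoint A z) = 0 := by
  refine ext_inner_right ℝ fun y => ?_
  rw [inner_nullProj_left, ContinuousLinearMap.adjoint_inner_left, apply_nullProj]
  simp

lemma inner_eq_zero_of_mem_range_adjoint {A : Euc n →L[ℝ] Euc m} {y z : Euc n}
    (hy : y ∈ LinearMap.range (ContinuousLinearMap.adjoint A : Euc m →ₗ[ℝ] Euc n))
    (hz : A z = 0) : ⟪y, z⟫ = 0 := by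
  obtain ⟨t, rfl⟩ := hy
  simp only [ContinuousLinearMap.coe_coe]
  rw [ContinuousLinearMap.adjoint_inner_left, hz, inner_zero_right]

lemma mul_norm_sub_nullProj_le {A : Euc n →L[ℝ] Euc m} {γ : ℝ} (hγ : 0 < γ)
    (h : ∀ z, γ * ‖z‖ ≤ ‖ContinuousLinearMap.adjoint A z‖) (y : Euc n) :
    γ * ‖y - nullProj A y‖ ≤ ‖A y‖ := by
  have h1 := mul_norm_le_norm_apply_of_mem_range hγ h (sub_nullProj_mem_range_adjoint A y)
  rwa [map_sub, apply_nullProj, sub_zero] at h1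

/-! ### Gradients, Hessians and Taylor estimates -/

lemma contDiffAt_gradient {h : Euc n → ℝ} {x : Euc n} (hh : ContDiffAt ℝ 2 h x) :
    ContDiffAt ℝ 1 (∇ h) x := by
  have h1 : ContDiffAt ℝ 1 (fderiv ℝ h) x := hh.fderiv_right (by norm_num)
  exact ((InnerProductSpace.toDual ℝ (Euc n)).symm.contDiff.contDiffAt).comp x h1

lemma continuousAt_hess {h : Euc n → ℝ} {x : Euc n} (hh : ContDiffAt ℝ 2 h x) :
    ContinuousAt (hess h) x :=
  ((contDiffAt_gradient hh).fderiv_right (m := 0) (by norm_num)).continuousAt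

lemma contDiffAt_con {c : Euc n → Euc m} {x : Euc n} {k : WithTop ℕ∞}
    (hc : ContDiffAt ℝ k c x) (i : Fin m) : ContDiffAt ℝ k (con c i) x :=
  contDiffAt_piLp 2 |>.1 hc i

lemma hasFDerivAt_toDual_gradient {h : Euc n → ℝ} {x : Euc n} (hh : DifferentiableAt ℝ h x) :
    HasFDerivAt h (InnerProductSpace.toDual ℝ _ (∇ h x)) x :=
  hasGradientAt_iff_hasFDerivAt.1 hh.hasGradientAt

lemma hess_isSymmetric {h : Euc n → ℝ} {x : Euc n} (hh : ContDiffAt ℝ 2 h x) :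
    (hess h x : Euc n →ₗ[ℝ] Euc n).IsSymmetric := by
  have hs : IsSymmSndFDerivAt ℝ h x := hh.isSymmSndFDerivAt (by simp)
  have hd : DifferentiableAt ℝ (fderiv ℝ h) x :=
    (hh.fderiv_right (m := 1) (by norm_num)).differentiableAt (by norm_num)
  have key : ∀ u v : Euc n, ⟪hess h x u, v⟫ = fderiv ℝ (fderiv ℝ h) x u v := by
    intro u v
    have hg : HasFDerivAt (∇ h) (hess h x) x :=
      ((contDiffAt_gradient hh).differentiableAt (by norm_num)).hasFDerivAt
    have h1 := hg.inner ℝ (hasFDerivAt_const v x)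
    have h2 := hd.hasFDerivAt.clm_apply (hasFDerivAt_const v x)
    have h3 : (fun y => ⟪∇ h y, v⟫) = fun y => fderiv ℝ h y v :=
      funext fun y => inner_gradient_left
    rw [h3] at h1
    simpa using DFunLike.congr_fun (h1.unique h2) u
  intro u v
  simp only [ContinuousLinearMap.coe_coe]
  rw [key, real_inner_comm, key, hs.eq]

/-- A function with Lipschitz derivative is approximated to second order by its linearization. -/
lemma norm_sub_linearization_le {E : Type*} [NormedAddCommGroup E] [NormedSpace ℝ E]
    {F : Euc n → E} {F' : Euc n → Euc n →L[ℝ] E} {X : Set (Euc n)} (hX : Convex ℝ X)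
    (hF : ∀ z ∈ X, HasFDerivAt F (F' z) z) {L : ℝ} (hL : 0 ≤ L) {x y : Euc n} (hx : x ∈ X)
    (hy : y ∈ X) (hlip : ∀ z ∈ X, ‖F' z - F' x‖ ≤ L * ‖z - x‖) :
    ‖F y - F x - F' x (y - x)‖ ≤ L * ‖y - x‖ ^ 2 := by
  have hsub : segment ℝ x y ⊆ X := hX.segment_subset hx hy
  have := (convex_segment x y).norm_image_sub_le_of_norm_hasFDerivWithin_le' (φ := F' x)
    (C := L * ‖y - x‖) (fun z hz => (hF z (hsub hz)).hasFDerivWithinAt)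
    (fun z hz => (hlip z (hsub hz)).trans ?_) (left_mem_segment ℝ x y) (right_mem_segment ℝ x y)
  · calc _ ≤ _ := this
      _ = _ := by ring
  · gcongr
    rw [← dist_eq_norm, ← dist_eq_norm, dist_comm z x, dist_comm y x]
    have := dist_add_dist_of_mem_segment hz
    linarith [dist_nonneg (x := z) (y := y)]

/-- `h` is `C²` on `X`, and the single constant `K` bounds `h`, its gradient, its Hessian, the
Lipschitz constant of the gradient, and the first- and second-order Taylor remainders. -/
structure SmoothBounds (h : Euc n → ℝ) (X : Set (Euc n)) (K : ℝ) : Prop where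
  contDiffAt : ∀ x ∈ X, ContDiffAt ℝ 2 h x
  abs_le : ∀ x ∈ X, |h x| ≤ K
  grad_le : ∀ x ∈ X, ‖∇ h x‖ ≤ K
  grad_lip : ∀ x ∈ X, ∀ y ∈ X, ‖∇ h y - ∇ h x‖ ≤ K * ‖y - x‖
  hess_le : ∀ x ∈ X, ‖hess h x‖ ≤ K
  taylor_one : ∀ x ∈ X, ∀ y ∈ X, |h y - h x - ⟪∇ h x, y - x⟫| ≤ K * ‖y - x‖ ^ 2
  taylor_two : ∀ x ∈ X, ∀ y ∈ X,
    |h y - h x - ⟪∇ h x, y - x⟫ - 1 / 2 * ⟪y - x, hess h x (y - x)⟫| ≤ K * ‖y - x‖ ^ 3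

lemma SmoothBounds.mono {h : Euc n → ℝ} {X : Set (Euc n)} {K K' : ℝ} (hb : SmoothBounds h X K)
    (hK : K ≤ K') : SmoothBounds h X K' where
  contDiffAt := hb.contDiffAt
  abs_le x hx := (hb.abs_le x hx).trans hK
  grad_le x hx := (hb.grad_le x hx).trans hK
  grad_lip x hx y hy := (hb.grad_lip x hx y hy).trans (by gcongr)
  hess_le x hx := (hb.hess_le x hx).trans hK
  taylor_one x hx y hy := (hb.taylor_one x hx y hy).trans (by gcongr)
  taylor_two x hx y hy := (hb.taylor_two x hx y hy).trans (by gcongr)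

lemma abs_taylor_two_le {h : Euc n → ℝ} {X : Set (Euc n)} (hX : Convex ℝ X)
    (hh : ∀ x ∈ X, ContDiffAt ℝ 2 h x) {L : ℝ} (hL : 0 ≤ L)
    (hlip : ∀ x ∈ X, ∀ y ∈ X, ‖hess h y - hess h x‖ ≤ L * ‖y - x‖)
    {x y : Euc n} (hx : x ∈ X) (hy : y ∈ X) :
    |h y - h x - ⟪∇ h x, y - x⟫ - 1 / 2 * ⟪y - x, hess h x (y - x)⟫| ≤ L * ‖y - x‖ ^ 3 := by
  have hsub : segment ℝ x y ⊆ X := hX.segment_subset hx hy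
  have hgrad : ∀ z ∈ X, ‖∇ h z - ∇ h x - hess h x (z - x)‖ ≤ L * ‖z - x‖ ^ 2 := fun z hz =>
    norm_sub_linearization_le hX (F := ∇ h) (F' := hess h)
      (fun w hw => ((contDiffAt_gradient (hh w hw)).differentiableAt (by norm_num)).hasFDerivAt)
      hL hx hz (fun w hw => hlip x hx w hw)
  -- The mean value inequality for `h` minus its quadratic part.
  have hder : ∀ z ∈ segment ℝ x y, HasFDerivWithinAt
      (fun z => h z - 1 / 2 * ⟪z - x, hess h x (z - x)⟫)
      (InnerProductSpace.toDual ℝ _ (∇ h z - hess h x (z - x))) (segment ℝ x y) z := by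
    intro z hz
    have h1 := hasFDerivAt_toDual_gradient ((hh z (hsub hz)).differentiableAt (by norm_num))
    have h2 : HasFDerivAt (fun z : Euc n => z - x) (ContinuousLinearMap.id ℝ _) z :=
      (hasFDerivAt_id z).sub_const x
    have h3 : HasFDerivAt (fun z : Euc n => hess h x (z - x)) (hess h x) z :=
      (hess h x).hasFDerivAt.comp z h2
    have h4 := h1.sub ((h2.inner ℝ h3).const_mul (1 / 2 : ℝ))
    refine HasFDerivAt.hasFDerivWithinAt ?_
    convert! h4 using 1
    ext v
    have hs : ⟪hess h x (z - x), v⟫ = ⟪z - x, hess h x v⟫ :=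
      hess_isSymmetric (hh x hx) (z - x) v
    have hc : ⟪v, hess h x (z - x)⟫ = ⟪hess h x (z - x), v⟫ := real_inner_comm _ _
    simp only [InnerProductSpace.toDual_apply_apply, sub_apply,
      smul_apply, ContinuousLinearMap.comp_apply,
      ContinuousLinearMap.prod_apply, fderivInnerCLM_apply, ContinuousLinearMap.id_apply,
      inner_sub_left, smul_eq_mul]
    rw [inner_sub_left] at hs
    linarith
  have := (convex_segment x y).norm_image_sub_le_of_norm_hasFDerivWithin_le'
    (φ := InnerProductSpace.toDual ℝ _ (∇ h x)) (C := L * ‖y - x‖ ^ 2) hder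
    (fun z hz => ?_) (left_mem_segment ℝ x y) (right_mem_segment ℝ x y)
  · rw [Real.norm_eq_abs] at this
    simp only [InnerProductSpace.toDual_apply_apply, sub_self, map_zero, inner_zero_left] at this
    calc _ = |h y - 1 / 2 * ⟪y - x, hess h x (y - x)⟫ - (h x - 1 / 2 * 0) - ⟪∇ h x, y - x⟫| := by
          congr 1; ring
      _ ≤ _ := this
      _ = _ := by ring
  · rw [← map_sub, LinearIsometryEquiv.norm_map]
    have h1 := hgrad z (hsub hz)
    have h2 : ‖z - x‖ ≤ ‖y - x‖ := by
      rw [← dist_eq_norm, ← dist_eq_norm, dist_comm z x, dist_comm y x]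
      have := dist_add_dist_of_mem_segment hz
      linarith [dist_nonneg (x := z) (y := y)]
    calc _ = ‖∇ h z - ∇ h x - hess h x (z - x)‖ := by congr 1; abel
      _ ≤ L * ‖z - x‖ ^ 2 := h1
      _ ≤ _ := by gcongr

lemma exists_smoothBounds {h : Euc n → ℝ} {X : Set (Euc n)} (hX : Convex ℝ X)
    (hh : ∀ x ∈ X, ContDiffAt ℝ 2 h x) (h0 : BddLipschitzOn h X) (h1 : BddLipschitzOn (∇ h) X)
    (h2 : BddLipschitzOn (hess h) X) : ∃ K, 0 ≤ K ∧ SmoothBounds h X K := by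
  obtain ⟨⟨k0, hk0⟩, -⟩ := h0
  obtain ⟨⟨k1, hk1⟩, L1, hL1⟩ := h1
  obtain ⟨⟨k2, hk2⟩, L2, hL2⟩ := h2
  have hl1 : ∀ x ∈ X, ∀ y ∈ X, ‖∇ h y - ∇ h x‖ ≤ L1 * ‖y - x‖ := fun x hx y hy => by
    simpa [dist_eq_norm] using hL1.dist_le_mul y hy x hx
  have hl2 : ∀ x ∈ X, ∀ y ∈ X, ‖hess h y - hess h x‖ ≤ L2 * ‖y - x‖ := fun x hx y hy => by
    simpa [dist_eq_norm] using hL2.dist_le_mul y hy x hx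
  have a0 := abs_nonneg k0
  have a1 := abs_nonneg k1
  have a2 := abs_nonneg k2
  have e0 := le_abs_self k0
  have e1 := le_abs_self k1
  have e2 := le_abs_self k2
  have hK1 : (L1 : ℝ) ≤ |k0| + |k1| + |k2| + L1 + L2 := by linarith [L2.coe_nonneg]
  have hK2 : (L2 : ℝ) ≤ |k0| + |k1| + |k2| + L1 + L2 := by linarith [L1.coe_nonneg]
  refine ⟨|k0| + |k1| + |k2| + L1 + L2, by positivity, hh, fun x hx => ?_, fun x hx => ?_,
    fun x hx y hy => ?_, fun x hx => ?_, fun x hx y hy => ?_, fun x hx y hy => ?_⟩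
  · have := hk0 x hx
    rw [Real.norm_eq_abs] at this
    linarith [L1.coe_nonneg, L2.coe_nonneg]
  · linarith [hk1 x hx, L1.coe_nonneg, L2.coe_nonneg]
  · exact (hl1 x hx y hy).trans (by gcongr)
  · linarith [hk2 x hx, L1.coe_nonneg, L2.coe_nonneg]
  · have := norm_sub_linearization_le hX (F := h)
      (F' := fun z => InnerProductSpace.toDual ℝ _ (∇ h z))
      (fun w hw => hasFDerivAt_toDual_gradient ((hh w hw).differentiableAt (by norm_num)))
      L1.coe_nonneg hx hy (fun w hw => by
        rw [← map_sub, LinearIsometryEquiv.norm_map]; exact hl1 x hx w hw)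
    simp only [InnerProductSpace.toDual_apply_apply, Real.norm_eq_abs] at this
    exact this.trans (by gcongr)
  · exact (abs_taylor_two_le hX hh L2.coe_nonneg hl2 hx hy).trans (by gcongr)

lemma jac_apply {c : Euc n → Euc m} {x : Euc n} (hc : DifferentiableAt ℝ c x) (y : Euc n)
    (i : Fin m) : jac c x y i = ⟪∇ (con c i) x, y⟫ := by
  rw [inner_gradient_left, jac]
  have h1 : HasFDerivAt (con c i) ((PiLp.proj 2 (fun _ : Fin m => ℝ) i) ∘L (fderiv ℝ c x)) x :=
    (PiLp.proj 2 (fun _ : Fin m => ℝ) i : Euc m →L[ℝ] ℝ).hasFDerivAt.comp x hc.hasFDerivAt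
  rw [h1.fderiv]
  simp

lemma gradLagrangian_eq {f : Euc n → ℝ} {c : Euc n → Euc m} {x : Euc n}
    (hf : DifferentiableAt ℝ f x) (hc : DifferentiableAt ℝ c x) (lam : Euc m) :
    gradLagrangian f c x lam = ∇ f x + ContinuousLinearMap.adjoint (jac c x) lam := by
  refine HasGradientAt.gradient ?_
  rw [hasGradientAt_iff_hasFDerivAt]
  have h1 := hasFDerivAt_toDual_gradient hf
  have h2 : HasFDerivAt (fun y => ⟪lam, c y⟫) ((innerSL ℝ lam) ∘L (fderiv ℝ c x)) x :=
    (innerSL ℝ lam).hasFDerivAt.comp x hc.hasFDerivAt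
  convert! h1.add h2 using 1
  ext y
  simp only [InnerProductSpace.toDual_apply_apply, inner_add_left, add_apply,
    ContinuousLinearMap.comp_apply, innerSL_apply_apply,
    ContinuousLinearMap.adjoint_inner_left, jac]

/-- The regularity assumptions on the problem, with one constant `K` for the upper bounds and one
constant `γ` for the lower bound on the singular values of the Jacobian. -/
structure ProblemBounds (f : Euc n → ℝ) (c : Euc n → Euc m) (X : Set (Euc n)) (K γ : ℝ) :
    Prop where
  K_pos : 0 < K
  γ_pos : 0 < γ
  f_bounds : SmoothBounds f X K
  diff_c : ∀ x ∈ X, DifferentiableAt ℝ c x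
  contDiffAt_con : ∀ x ∈ X, ∀ i, ContDiffAt ℝ 2 (con c i) x
  jac_le : ∀ x ∈ X, ∀ y, l1 (jac c x y) ≤ K * ‖y‖
  jac_lip : ∀ x ∈ X, ∀ y ∈ X, ∀ z, l1 (jac c y z - jac c x z) ≤ K * ‖y - x‖ * ‖z‖
  taylor_one : ∀ x ∈ X, ∀ y ∈ X, l1 (c y - c x - jac c x (y - x)) ≤ K * ‖y - x‖ ^ 2
  taylor_two : ∀ x ∈ X, ∀ y ∈ X, ∀ lam : Euc m,
    |⟪lam, c y - c x - jac c x (y - x)⟫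
      - 1 / 2 * ⟪y - x, (∑ i, lam i • hess (con c i) x) (y - x)⟫| ≤ K * ‖lam‖ * ‖y - x‖ ^ 3
  hess_le : ∀ x ∈ X, ∀ lam : Euc m, ‖∑ i, lam i • hess (con c i) x‖ ≤ K * ‖lam‖
  adjoint_ge : ∀ x ∈ X, ∀ z, γ * ‖z‖ ≤ ‖ContinuousLinearMap.adjoint (jac c x) z‖

lemma exists_problemBounds {f : Euc n → ℝ} {c : Euc n → Euc m} {X : Set (Euc n)}
    (hXo : IsOpen X) (hX : Convex ℝ X) (h1 : F1 f c X) (h2 : F2 c X) (h5 : F5 f c X) :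
    ∃ K γ, ProblemBounds f c X K γ := by
  have hf : ∀ x ∈ X, ContDiffAt ℝ 2 f x := fun x hx => h1.f_smooth.contDiffAt (hXo.mem_nhds hx)
  have hc : ∀ x ∈ X, ContDiffAt ℝ 2 c x := fun x hx => h1.c_smooth.contDiffAt (hXo.mem_nhds hx)
  have hci : ∀ x ∈ X, ∀ i, ContDiffAt ℝ 2 (con c i) x := fun x hx i => contDiffAt_con (hc x hx) i
  have hcd : ∀ x ∈ X, DifferentiableAt ℝ c x := fun x hx => (hc x hx).differentiableAt (by norm_num)
  obtain ⟨Kf, hKf0, hKf⟩ := exists_smoothBounds hX hf h1.f_bdd h1.g_bdd h5.f_hess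
  choose Ki hKi0 hKi using fun i => exists_smoothBounds hX (fun x hx => hci x hx i) (h1.c_bdd i)
    (h1.gc_bdd i) (h5.c_hess i)
  obtain ⟨γ, hγ, hγX⟩ := h2
  have hS0 : 0 ≤ ∑ i, Ki i := Finset.sum_nonneg fun i _ => hKi0 i
  have hS : ∑ i, Ki i ≤ Kf + ∑ i, Ki i + 1 := by linarith
  have hlam : ∀ (lam : Euc m) i, |lam i| ≤ ‖lam‖ := fun lam i => by
    simpa using PiLp.norm_apply_le lam i
  refine ⟨Kf + ∑ i, Ki i + 1, γ, by positivity, hγ, hKf.mono (by linarith), hcd, hci,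
    fun x hx y => ?_, fun x hx y hy z => ?_, fun x hx y hy => ?_,
    fun x hx y hy lam => ?_, fun x hx lam => ?_,
    fun x hx => mul_norm_le_norm_adjoint hγ (hγX x hx)⟩
  · refine le_trans ?_ (mul_le_mul_of_nonneg_right hS (norm_nonneg _))
    rw [Finset.sum_mul]
    refine Finset.sum_le_sum fun i _ => ?_
    rw [jac_apply (hcd x hx)]
    exact (abs_real_inner_le_norm _ _).trans (by gcongr; exact (hKi i).grad_le x hx)
  · rw [mul_assoc]
    refine le_trans ?_ (mul_le_mul_of_nonneg_right hS (by positivity))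
    rw [Finset.sum_mul]
    refine Finset.sum_le_sum fun i _ => ?_
    rw [PiLp.sub_apply, jac_apply (hcd x hx), jac_apply (hcd y hy), ← inner_sub_left, ← mul_assoc]
    exact (abs_real_inner_le_norm _ _).trans (by gcongr; exact (hKi i).grad_lip x hx y hy)
  · refine le_trans ?_ (mul_le_mul_of_nonneg_right hS (by positivity))
    rw [Finset.sum_mul]
    refine Finset.sum_le_sum fun i _ => ?_
    rw [PiLp.sub_apply, PiLp.sub_apply, jac_apply (hcd x hx)]
    exact (hKi i).taylor_one x hx y hy
  · rw [mul_assoc]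
    refine le_trans ?_ (mul_le_mul_of_nonneg_right hS (by positivity))
    rw [Finset.sum_mul]
    have : ⟪lam, c y - c x - jac c x (y - x)⟫
        - 1 / 2 * ⟪y - x, (∑ i, lam i • hess (con c i) x) (y - x)⟫
        = ∑ i, lam i * (con c i y - con c i x - ⟪∇ (con c i) x, y - x⟫
          - 1 / 2 * ⟪y - x, hess (con c i) x (y - x)⟫) := by
      rw [PiLp.inner_apply, sum_apply, inner_sum, Finset.mul_sum,
        ← Finset.sum_sub_distrib]
      refine Finset.sum_congr rfl fun i _ => ?_
      rw [PiLp.sub_apply, PiLp.sub_apply, jac_apply (hcd x hx), smul_apply,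
        inner_smul_right]
      simp only [RCLike.inner_apply, conj_trivial, con]
      ring
    rw [this]
    refine (Finset.abs_sum_le_sum_abs _ _).trans (Finset.sum_le_sum fun i _ => ?_)
    rw [abs_mul]
    calc _ ≤ ‖lam‖ * (Ki i * ‖y - x‖ ^ 3) :=
          mul_le_mul (hlam lam i) ((hKi i).taylor_two x hx y hy) (abs_nonneg _) (norm_nonneg _)
      _ = _ := by ring
  · refine le_trans ?_ (mul_le_mul_of_nonneg_right hS (by positivity))
    rw [Finset.sum_mul]
    refine (norm_sum_le _ _).trans (Finset.sum_le_sum fun i _ => ?_)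
    rw [norm_smul, Real.norm_eq_abs, mul_comm]
    gcongr
    · exact hKi0 i
    · exact (hKi i).hess_le x hx
    · exact hlam lam i

lemma hessLagrangian_isSymmetric {f : Euc n → ℝ} {c : Euc n → Euc m} {X : Set (Euc n)} {K γ : ℝ}
    (hb : ProblemBounds f c X K γ) {x : Euc n} (hx : x ∈ X) (lam : Euc m) :
    (hessLagrangian f c x lam : Euc n →ₗ[ℝ] Euc n).IsSymmetric := by
  intro u v
  have h1 := hess_isSymmetric (hb.f_bounds.contDiffAt x hx) u v
  have h2 := fun i => hess_isSymmetric (hb.contDiffAt_con x hx i) u v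
  simp only [ContinuousLinearMap.coe_coe, hessLagrangian, add_apply,
    sum_apply, smul_apply, inner_add_left, inner_add_right,
    sum_inner, inner_sum, inner_smul_left, inner_smul_right, conj_trivial] at h1 h2 ⊢
  rw [h1]
  congr 1
  exact Finset.sum_congr rfl fun i _ => by rw [h2 i]

/-! ### A run under uniform bounds: the normal step -/

/-- A run of the algorithm together with explicit constants: `K` and `γ` for the problem data, `κ`
for the Hessians of the Lagrangian. -/
structure BoundedRun (p : Params) (f : Euc n → ℝ) (c : Euc n → Euc m) (s : Iterates n m)
    (X : Set (Euc n)) (K γ κ : ℝ) : Prop where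
  run : s.IsRun p f c
  dom : s.Domain p f c X
  prob : ProblemBounds f c X K γ
  κ_pos : 0 < κ
  H_le : ∀ k, ‖s.H f c k‖ ≤ κ

namespace BoundedRun

variable {p : Params} {f : Euc n → ℝ} {c : Euc n → Euc m} {s : Iterates n m} {X : Set (Euc n)}
  {K γ κ : ℝ}

lemma sigmaMin_le_sig (hr : BoundedRun p f c s X K γ κ) (k : ℕ) : p.sigmaMin ≤ s.sig k := by
  induction k with
  | zero => exact hr.run.sig_zero
  | succ k ih =>
    by_cases hs : s.Successful p f c k
    · by_cases hv : s.VerySuccessful p f c k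
      · exact (le_max_left _ _).trans (hr.run.sig_very k hv).1
      · rw [hr.run.sig_succ k hs hv]; exact ih
    · have h1 := (hr.run.sig_unsucc k hs).1
      nlinarith [p.one_lt_gam₁, p.sigmaMin_pos]

lemma sig_pos (hr : BoundedRun p f c s X K γ κ) (k : ℕ) : 0 < s.sig k :=
  p.sigmaMin_pos.trans_le (hr.sigmaMin_le_sig k)

lemma one_sub_rv_pos (p : Params) : 0 < 1 - p.rv - p.tau := by linarith [p.rv_mem.2]

lemma adjoint_ge (hr : BoundedRun p f c s X K γ κ) (k : ℕ) (z : Euc m) :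
    γ * ‖z‖ ≤ ‖ContinuousLinearMap.adjoint (s.A c k) z‖ :=
  hr.prob.adjoint_ge _ (hr.dom.iterate_mem k) z

lemma mul_norm_le_of_mem_range (hr : BoundedRun p f c s X K γ κ) (k : ℕ) {y : Euc n}
    (hy : y ∈ LinearMap.range (ContinuousLinearMap.adjoint (s.A c k) : Euc m →ₗ[ℝ] Euc n)) :
    γ * ‖y‖ ≤ ‖s.A c k y‖ :=
  mul_norm_le_norm_apply_of_mem_range hr.prob.γ_pos (hr.adjoint_ge k) hy

lemma l1_A_le (hr : BoundedRun p f c s X K γ κ) (k : ℕ) (y : Euc n) :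
    l1 (s.A c k y) ≤ K * ‖y‖ :=
  hr.prob.jac_le _ (hr.dom.iterate_mem k) y

lemma norm_g_le (hr : BoundedRun p f c s X K γ κ) (k : ℕ) : ‖s.g f k‖ ≤ K :=
  hr.prob.f_bounds.grad_le _ (hr.dom.iterate_mem k)

lemma norm_H_apply_le (hr : BoundedRun p f c s X K γ κ) (k : ℕ) (y : Euc n) :
    ‖s.H f c k y‖ ≤ κ * ‖y‖ :=
  (s.H f c k).le_of_opNorm_le (hr.H_le k) y

lemma abs_inner_H_le (hr : BoundedRun p f c s X K γ κ) (k : ℕ) (y : Euc n) :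
    |⟪y, s.H f c k y⟫| ≤ κ * ‖y‖ ^ 2 := by
  have h1 := abs_real_inner_le_norm y (s.H f c k y)
  have h2 := hr.norm_H_apply_le k y
  nlinarith [norm_nonneg y]

lemma inner_H_comm (hr : BoundedRun p f c s X K γ κ) (k : ℕ) (y z : Euc n) :
    ⟪s.H f c k y, z⟫ = ⟪y, s.H f c k z⟫ :=
  hessLagrangian_isSymmetric hr.prob (hr.dom.iterate_mem k) (s.lam k) y z

lemma l1_resid_le (hr : BoundedRun p f c s X K γ κ) (k : ℕ) :
    l1 (s.A c k (s.vc k) + c (s.x k)) ≤ p.rv * l1 (c (s.x k)) :=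
  (hr.run.normal k).resid.trans (mul_le_mul_of_nonneg_left (min_le_left _ _) p.rv_mem.1)

lemma mul_norm_vc_le (hr : BoundedRun p f c s X K γ κ) (k : ℕ) :
    γ * ‖s.vc k‖ ≤ 2 * l1 (c (s.x k)) := by
  have h1 := hr.mul_norm_le_of_mem_range k (hr.run.normal k).mem_range
  have h2 := norm_le_l1 (s.A c k (s.vc k))
  have h3 := l1_add_le (s.A c k (s.vc k) + c (s.x k)) (-c (s.x k))
  rw [add_neg_cancel_right, l1_neg] at h3
  have h4 := hr.l1_resid_le k
  nlinarith [l1_nonneg (c (s.x k)), p.rv_mem.2, p.tau_mem.1]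

lemma l1_le_norm_vc (hr : BoundedRun p f c s X K γ κ) (k : ℕ) :
    (1 - p.rv) * l1 (c (s.x k)) ≤ K * ‖s.vc k‖ := by
  have h1 := hr.l1_A_le k (s.vc k)
  have h3 := l1_add_le (s.A c k (s.vc k) + c (s.x k)) (-(s.A c k (s.vc k)))
  rw [add_assoc, add_comm (c (s.x k)), add_neg_cancel_left, l1_neg] at h3
  have h4 := hr.l1_resid_le k
  linarith

lemma vc_eq_zero_iff (hr : BoundedRun p f c s X K γ κ) (k : ℕ) :
    s.vc k = 0 ↔ c (s.x k) = 0 := by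
  refine ⟨fun h => ?_, (hr.run.normal k).eq_zero⟩
  have h1 := hr.l1_le_norm_vc k
  rw [h, norm_zero, mul_zero] at h1
  rw [← l1_eq_zero_iff]
  have h2 := one_sub_rv_pos p
  have h3 := l1_nonneg (c (s.x k))
  nlinarith [p.tau_mem.1]

lemma bet_mem_Ioc (hr : BoundedRun p f c s X K γ κ) (k : ℕ) (hc : c (s.x k) ≠ 0) :
    s.bet k ∈ Ioc (0 : ℝ) 1 := by
  have h := (hr.run.normal k).bet_mem hc
  have hvc : 0 < ‖s.vc k‖ := norm_pos_iff.2 fun h => hc ((hr.vc_eq_zero_iff k).1 h)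
  have hσ := Real.sqrt_pos.2 (hr.sig_pos k)
  have hθ := p.theta_mem.1
  exact ⟨lt_of_lt_of_le (lt_min one_pos (by positivity)) h.1, h.2.trans (min_le_left _ _)⟩

lemma bet_mul_l1_nonneg (hr : BoundedRun p f c s X K γ κ) (k : ℕ) :
    0 ≤ s.bet k * l1 (c (s.x k)) := by
  by_cases hc : c (s.x k) = 0
  · rw [hc, l1_zero, mul_zero]
  · exact mul_nonneg (hr.bet_mem_Ioc k hc).1.le (l1_nonneg _)

lemma norm_v_eq (hr : BoundedRun p f c s X K γ κ) (k : ℕ) :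
    ‖s.v k‖ = s.bet k * ‖s.vc k‖ := by
  by_cases hc : c (s.x k) = 0
  · simp [Iterates.v, (hr.vc_eq_zero_iff k).2 hc]
  · rw [Iterates.v, norm_smul, Real.norm_of_nonneg (hr.bet_mem_Ioc k hc).1.le]

lemma norm_v_le_norm_vc (hr : BoundedRun p f c s X K γ κ) (k : ℕ) : ‖s.v k‖ ≤ ‖s.vc k‖ := by
  rw [hr.norm_v_eq]
  by_cases hc : c (s.x k) = 0
  · simp [(hr.vc_eq_zero_iff k).2 hc]
  · exact mul_le_of_le_one_left (norm_nonneg _) (hr.bet_mem_Ioc k hc).2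

lemma mul_norm_v_le (hr : BoundedRun p f c s X K γ κ) (k : ℕ) :
    γ * ‖s.v k‖ ≤ 2 * (s.bet k * l1 (c (s.x k))) := by
  rw [hr.norm_v_eq]
  by_cases hc : c (s.x k) = 0
  · simp [(hr.vc_eq_zero_iff k).2 hc, hc, l1_zero]
  · have h1 := hr.mul_norm_vc_le k
    have h2 := (hr.bet_mem_Ioc k hc).1
    nlinarith

lemma norm_v_mul_sqrt_le (hr : BoundedRun p f c s X K γ κ) (k : ℕ) :
    ‖s.v k‖ * √(s.sig k) ≤ 1 := by
  rw [hr.norm_v_eq]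
  by_cases hc : c (s.x k) = 0
  · simp [(hr.vc_eq_zero_iff k).2 hc]
  · have h := ((hr.run.normal k).bet_mem hc).2.trans (min_le_right _ _)
    have hvc : 0 < ‖s.vc k‖ := norm_pos_iff.2 fun h => hc ((hr.vc_eq_zero_iff k).1 h)
    have hσ := Real.sqrt_pos.2 (hr.sig_pos k)
    rw [le_div_iff₀ (by positivity)] at h
    linarith

lemma min_le_norm_v (hr : BoundedRun p f c s X K γ κ) (k : ℕ) :
    min ‖s.vc k‖ (p.theta / √(s.sig k)) ≤ ‖s.v k‖ := by
  rw [hr.norm_v_eq]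
  by_cases hc : c (s.x k) = 0
  · simp [(hr.vc_eq_zero_iff k).2 hc]
  · have h := ((hr.run.normal k).bet_mem hc).1
    have hvc : 0 < ‖s.vc k‖ := norm_pos_iff.2 fun h => hc ((hr.vc_eq_zero_iff k).1 h)
    have hσ := Real.sqrt_pos.2 (hr.sig_pos k)
    rcases min_le_iff.1 h with h | h
    · exact (min_le_left _ _).trans (by nlinarith)
    · refine (min_le_right _ _).trans ?_
      rw [div_le_iff₀ (by positivity)] at h ⊢
      linarith

/-- In a nearly feasible iteration the normal step is not scaled back. -/
lemma v_eq_vc_of_nearFeasible (hr : BoundedRun p f c s X K γ κ) (k : ℕ)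
    (h : s.NearFeasible p k) : s.v k = s.vc k := by
  by_cases hc : c (s.x k) = 0
  · simp [Iterates.v, (hr.vc_eq_zero_iff k).2 hc]
  · have h1 := ((hr.run.normal k).bet_mem hc)
    have hvc : 0 < ‖s.vc k‖ := norm_pos_iff.2 fun h => hc ((hr.vc_eq_zero_iff k).1 h)
    have hσ := Real.sqrt_pos.2 (hr.sig_pos k)
    have h2 : 1 ≤ p.theta / (‖s.vc k‖ * √(s.sig k)) := by
      rw [le_div_iff₀ (by positivity), one_mul]
      rw [Iterates.NearFeasible, le_div_iff₀ hσ] at h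
      exact h.trans p.zeta_mem.2.le
    have h3 : s.bet k = 1 :=
      le_antisymm (hr.bet_mem_Ioc k hc).2 ((le_min le_rfl h2).trans h1.1)
    rw [Iterates.v, h3, one_smul]

lemma v_mem_range (hr : BoundedRun p f c s X K γ κ) (k : ℕ) :
    s.v k ∈ LinearMap.range (ContinuousLinearMap.adjoint (s.A c k) : Euc m →ₗ[ℝ] Euc n) :=
  Submodule.smul_mem _ _ (hr.run.normal k).mem_range

lemma A_u (hr : BoundedRun p f c s X K γ κ) (k : ℕ) : s.A c k (s.u k) = 0 :=
  mem_range_nullProj_iff.1 (hr.run.tangential k).mem_range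

lemma A_d (hr : BoundedRun p f c s X K γ κ) (k : ℕ) :
    s.A c k (s.d k) = s.bet k • s.A c k (s.vc k) := by
  rw [Iterates.d, map_add, hr.A_u, add_zero, Iterates.v, map_smul]

lemma P_u (hr : BoundedRun p f c s X K γ κ) (k : ℕ) : s.P c k (s.u k) = s.u k :=
  nullProj_eq_self (hr.A_u k)

lemma inner_v_u (hr : BoundedRun p f c s X K γ κ) (k : ℕ) : ⟪s.v k, s.u k⟫ = 0 :=
  inner_eq_zero_of_mem_range_adjoint (hr.v_mem_range k) (hr.A_u k)

lemma norm_d_sq (hr : BoundedRun p f c s X K γ κ) (k : ℕ) :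
    ‖s.d k‖ ^ 2 = ‖s.v k‖ ^ 2 + ‖s.u k‖ ^ 2 := by
  rw [Iterates.d, norm_add_sq_real, hr.inner_v_u]; ring

/-- The linearized infeasibility decreases in proportion to the length of the normal step. -/
lemma l1_linearized_le (hr : BoundedRun p f c s X K γ κ) (k : ℕ) :
    l1 (c (s.x k) + s.A c k (s.d k)) ≤
      l1 (c (s.x k)) - (1 - p.rv) * (s.bet k * l1 (c (s.x k))) := by
  rw [hr.A_d]
  by_cases hc : c (s.x k) = 0
  · rw [(hr.vc_eq_zero_iff k).2 hc, hc]; simp [l1_zero]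
  · obtain ⟨hb0, hb1⟩ := hr.bet_mem_Ioc k hc
    have h1 : c (s.x k) + s.bet k • s.A c k (s.vc k)
        = (1 - s.bet k) • c (s.x k) + s.bet k • (s.A c k (s.vc k) + c (s.x k)) := by
      module
    rw [h1]
    refine (l1_add_le _ _).trans ?_
    rw [l1_smul, l1_smul, abs_of_nonneg (by linarith), abs_of_pos hb0]
    nlinarith [hr.l1_resid_le k]

/-! ### The tangential step -/

lemma gTilde_eq (k : ℕ) : s.gTilde f c k = s.P c k (s.g f k + s.H f c k (s.v k)) := by
  rw [Iterates.gTilde, Iterates.P, adjoint_nullProj]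

lemma HTilde_apply (k : ℕ) (y : Euc n) :
    s.HTilde f c k y = s.P c k (s.H f c k (s.P c k y)) := by
  rw [Iterates.HTilde, Iterates.P, adjoint_nullProj]; rfl

lemma inner_HTilde (k : ℕ) (y z : Euc n) :
    ⟪y, s.HTilde f c k z⟫ = ⟪s.P c k y, s.H f c k (s.P c k z)⟫ := by
  rw [HTilde_apply, Iterates.P, inner_nullProj_left]

lemma HTilde_isSymmetric (hr : BoundedRun p f c s X K γ κ) (k : ℕ) :
    (s.HTilde f c k : Euc n →ₗ[ℝ] Euc n).IsSymmetric := by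
  intro y z
  simp only [ContinuousLinearMap.coe_coe]
  rw [real_inner_comm, inner_HTilde, inner_HTilde, ← hr.inner_H_comm, real_inner_comm]

lemma neg_mul_le_inner_H (hr : BoundedRun p f c s X K γ κ) (k : ℕ) {y : Euc n}
    (hy : s.A c k y = 0) : -(s.sig k * ‖s.u k‖) * ‖y‖ ^ 2 ≤ ⟪y, s.H f c k y⟫ := by
  have h := le_inner_of_le_lambdaMin (hr.HTilde_isSymmetric k) (hr.run.tangential k).or3 y
  rwa [inner_HTilde, Iterates.P, nullProj_eq_self hy] at h

lemma hasFDerivAt_norm_cube (y : Euc n) :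
    HasFDerivAt (fun z : Euc n => ‖z‖ ^ 3) ((3 * ‖y‖) • innerSL ℝ y) y := by
  have h := hasFDerivAt_norm_rpow y (p := 3) (by norm_num)
  have h1 : (fun z : Euc n => ‖z‖ ^ (3 : ℝ)) = fun z => ‖z‖ ^ 3 :=
    funext fun z => by norm_cast
  have h2 : ‖y‖ ^ ((3 : ℝ) - 2) = ‖y‖ := by norm_num
  rwa [h1, h2] at h

lemma gradient_mU_u (hr : BoundedRun p f c s X K γ κ) (k : ℕ) :
    ∇ (s.mU f c k) (s.u k) =
      s.gTilde f c k + s.HTilde f c k (s.u k) + (s.sig k * ‖s.u k‖) • s.u k := by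
  refine HasGradientAt.gradient ?_
  rw [hasGradientAt_iff_hasFDerivAt]
  have h1 : HasFDerivAt (fun y : Euc n => ⟪s.gTilde f c k, y⟫) (innerSL ℝ (s.gTilde f c k))
      (s.u k) := (innerSL ℝ (s.gTilde f c k)).hasFDerivAt
  have h2 := (hasFDerivAt_id (s.u k)).inner ℝ (s.HTilde f c k).hasFDerivAt
  have h3 := (hasFDerivAt_norm_cube (s.P c k (s.u k))).comp (s.u k) (s.P c k).hasFDerivAt
  have h4 := ((h1.const_add (f (s.x k))).add (h2.const_mul (1 / 2 : ℝ))).add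
    (h3.const_mul (s.sig k / 3))
  convert! h4 using 1
  ext y
  have hs : ⟪s.HTilde f c k (s.u k), y⟫ = ⟪s.u k, s.HTilde f c k y⟫ :=
    hr.HTilde_isSymmetric k (s.u k) y
  have hc : ⟪y, s.HTilde f c k (s.u k)⟫ = ⟪s.HTilde f c k (s.u k), y⟫ := real_inner_comm _ _
  have hP : ⟪s.u k, s.P c k y⟫ = ⟪s.u k, y⟫ := by
    rw [Iterates.P, ← inner_nullProj_left, nullProj_eq_self (hr.A_u k)]
  simp only [InnerProductSpace.toDual_apply_apply, add_apply, smul_apply,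
    ContinuousLinearMap.comp_apply, ContinuousLinearMap.prod_apply, fderivInnerCLM_apply,
    ContinuousLinearMap.id_apply, inner_add_left, inner_smul_left, conj_trivial, smul_eq_mul,
    innerSL_apply_apply, hr.P_u, hP, id]
  rw [hc, ← hs]
  ring

/-- Conditions (OR2) and (OR3) alone force a model decrease of order `σ‖u‖³`. -/
lemma le_deltaM (hr : BoundedRun p f c s X K γ κ) (k : ℕ) :
    (1 / 6 - p.delta) * (s.sig k * ‖s.u k‖ ^ 3) ≤ s.deltaM f c k (s.u k) := by
  have h2 := (hr.run.tangential k).or2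
  have h3 := hr.neg_mul_le_inner_H k (hr.A_u k)
  have h4 := (abs_le.1 ((abs_real_inner_le_norm (∇ (s.mU f c k) (s.u k)) (s.u k)).trans
    (mul_le_mul_of_nonneg_right h2 (norm_nonneg _)))).2
  rw [hr.gradient_mU_u, inner_add_left, inner_add_left, inner_smul_left,
    real_inner_self_eq_norm_sq, real_inner_comm, real_inner_comm (s.u k) (s.HTilde f c k (s.u k)),
    inner_HTilde, hr.P_u] at h4
  simp only [Iterates.deltaM, Iterates.mU, inner_HTilde, hr.P_u, map_zero, norm_zero,
    inner_zero_right, conj_trivial] at h4 ⊢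
  rw [real_inner_comm] at h4
  nlinarith

lemma delta_lt (p : Params) : 0 < 1 / 6 - p.delta := by linarith [p.delta_mem.2]

lemma deltaM_nonneg (hr : BoundedRun p f c s X K γ κ) (k : ℕ) : 0 ≤ s.deltaM f c k (s.u k) := by
  have := hr.sig_pos k
  have := delta_lt p
  exact le_trans (by positivity) (hr.le_deltaM k)

lemma norm_HTilde_le (hr : BoundedRun p f c s X K γ κ) (k : ℕ) (y : Euc n) :
    ‖s.HTilde f c k y‖ ≤ κ * ‖y‖ := by
  rw [HTilde_apply]
  refine (norm_nullProj_le _ _).trans ((hr.norm_H_apply_le k _).trans ?_)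
  exact mul_le_mul_of_nonneg_left (norm_nullProj_le _ _) hr.κ_pos.le

lemma norm_gTilde_le (hr : BoundedRun p f c s X K γ κ) (k : ℕ) :
    ‖s.gTilde f c k‖ ≤ κ * ‖s.u k‖ + 2 * s.sig k * ‖s.u k‖ ^ 2 := by
  have h2 := (hr.run.tangential k).or2
  rw [hr.gradient_mU_u] at h2
  have h1 : s.gTilde f c k = (s.gTilde f c k + s.HTilde f c k (s.u k)
      + (s.sig k * ‖s.u k‖) • s.u k) - s.HTilde f c k (s.u k)
      - (s.sig k * ‖s.u k‖) • s.u k := by abel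
  have h3 := hr.norm_HTilde_le k (s.u k)
  have hσ := hr.sig_pos k
  have h4 : ‖(s.sig k * ‖s.u k‖) • s.u k‖ = s.sig k * ‖s.u k‖ ^ 2 := by
    rw [norm_smul, Real.norm_of_nonneg (by positivity)]; ring
  rw [h1]
  refine (norm_sub_le _ _).trans ?_
  refine (add_le_add_left (norm_sub_le _ _) _).trans ?_
  rw [h4]
  have h5 : p.delta * s.sig k * ‖s.u k‖ ^ 2 ≤ 1 * s.sig k * ‖s.u k‖ ^ 2 := by
    gcongr; linarith [p.delta_mem.2]
  linarith

/-- The reduced gradient is bounded by the lengths of the two step components. -/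
lemma norm_P_g_le (hr : BoundedRun p f c s X K γ κ) (k : ℕ) :
    ‖s.P c k (s.g f k)‖ ≤ κ * ‖s.v k‖ + κ * ‖s.u k‖ + 2 * s.sig k * ‖s.u k‖ ^ 2 := by
  have h1 := hr.norm_gTilde_le k
  have h2 : s.P c k (s.g f k) = s.gTilde f c k - s.P c k (s.H f c k (s.v k)) := by
    rw [gTilde_eq, map_add, add_sub_cancel_right]
  have h3 : ‖s.P c k (s.H f c k (s.v k))‖ ≤ κ * ‖s.v k‖ :=
    (norm_nullProj_le _ _).trans (hr.norm_H_apply_le k _)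
  rw [h2]
  linarith [norm_sub_le (s.gTilde f c k) (s.P c k (s.H f c k (s.v k)))]

/-! ### Uniform bounds on steps, multipliers and merit parameters -/

lemma sqrt_sigmaMin_pos (p : Params) : 0 < √p.sigmaMin := Real.sqrt_pos.2 p.sigmaMin_pos

lemma sqrt_sigmaMin_le (hr : BoundedRun p f c s X K γ κ) (k : ℕ) : √p.sigmaMin ≤ √(s.sig k) :=
  Real.sqrt_le_sqrt (hr.sigmaMin_le_sig k)

lemma sqrt_sig_pos (hr : BoundedRun p f c s X K γ κ) (k : ℕ) : 0 < √(s.sig k) :=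
  Real.sqrt_pos.2 (hr.sig_pos k)

lemma norm_v_le (hr : BoundedRun p f c s X K γ κ) (k : ℕ) : ‖s.v k‖ ≤ 1 / √p.sigmaMin := by
  rw [le_div_iff₀ (sqrt_sigmaMin_pos p)]
  exact (mul_le_mul_of_nonneg_left (hr.sqrt_sigmaMin_le k) (norm_nonneg _)).trans
    (hr.norm_v_mul_sqrt_le k)

lemma exists_sqrt_mul_norm_u_le (hr : BoundedRun p f c s X K γ κ) :
    ∃ C, 0 ≤ C ∧ ∀ k, √(s.sig k) * ‖s.u k‖ ≤ C := by
  have hK := hr.prob.K_pos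
  have hκ := hr.κ_pos
  have hr0 := sqrt_sigmaMin_pos p
  set r := √p.sigmaMin with hrdef
  refine ⟨3 * (K + κ * (1 / r)) + 3 * κ / (2 * r) + 1, by positivity, fun k => ?_⟩
  have hm := hr.deltaM_nonneg k
  simp only [Iterates.deltaM, Iterates.mU, inner_HTilde, hr.P_u, map_zero, norm_zero,
    inner_zero_right] at hm
  have hg : ‖s.gTilde f c k‖ ≤ K + κ * (1 / r) := by
    rw [gTilde_eq]
    refine (norm_nullProj_le _ _).trans ((norm_add_le _ _).trans (add_le_add (hr.norm_g_le k) ?_))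
    exact (hr.norm_H_apply_le k _).trans (mul_le_mul_of_nonneg_left (hr.norm_v_le k) hκ.le)
  have h1 := (abs_le.1 (abs_real_inner_le_norm (s.gTilde f c k) (s.u k))).1
  have h2 := (abs_le.1 (hr.abs_inner_H_le k (s.u k))).1
  have hG : 0 ≤ K + κ * (1 / r) := by positivity
  set G := K + κ * (1 / r)
  set a := ‖s.u k‖ with ha
  have ha0 : 0 ≤ a := norm_nonneg _
  have hσ0 := (hr.sqrt_sig_pos k).le
  have hσ := Real.sq_sqrt (hr.sig_pos k).le
  rcases ha0.eq_or_lt with h0 | h0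
  · rw [← h0, mul_zero]; positivity
  have h3 : s.sig k / 3 * a ^ 2 ≤ G + 1 / 2 * κ * a := by
    have : a * (s.sig k / 3 * a ^ 2) ≤ a * (G + 1 / 2 * κ * a) := by nlinarith
    exact le_of_mul_le_mul_left this h0
  have h4 : a ≤ √(s.sig k) * a / r := by
    rw [le_div_iff₀ hr0, mul_comm]
    exact mul_le_mul_of_nonneg_right (hr.sqrt_sigmaMin_le k) ha0
  set t := √(s.sig k) * a with ht
  have ht0 : 0 ≤ t := by positivity
  have h5 : t ^ 2 ≤ 3 * G + 3 * κ / (2 * r) * t := by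
    have e1 : t ^ 2 = s.sig k * a ^ 2 := by rw [ht, mul_pow, hσ]
    have e2 : κ * a ≤ κ * (t / r) := by gcongr
    have e3 : 3 * κ / (2 * r) * t = 3 / 2 * (κ * (t / r)) := by field_simp
    rw [e1, e3]
    linarith
  have hb : 0 ≤ 3 * κ / (2 * r) := by positivity
  by_contra! hlt
  nlinarith

lemma exists_sqrt_mul_norm_d_le (hr : BoundedRun p f c s X K γ κ) :
    ∃ C, 0 ≤ C ∧ ∀ k, √(s.sig k) * ‖s.d k‖ ≤ C := by
  obtain ⟨C, hC0, hC⟩ := hr.exists_sqrt_mul_norm_u_le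
  refine ⟨1 + C, by linarith, fun k => ?_⟩
  have h1 := mul_le_mul_of_nonneg_left (norm_add_le (s.v k) (s.u k)) (hr.sqrt_sig_pos k).le
  have h2 := hr.norm_v_mul_sqrt_le k
  have h3 := hC k
  rw [Iterates.d]
  linarith

lemma norm_v_le_norm_d (hr : BoundedRun p f c s X K γ κ) (k : ℕ) : ‖s.v k‖ ≤ ‖s.d k‖ := by
  refine le_of_sq_le_sq ?_ (norm_nonneg _)
  rw [hr.norm_d_sq]
  linarith [sq_nonneg ‖s.u k‖]

lemma norm_u_le_norm_d (hr : BoundedRun p f c s X K γ κ) (k : ℕ) : ‖s.u k‖ ≤ ‖s.d k‖ := by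
  refine le_of_sq_le_sq ?_ (norm_nonneg _)
  rw [hr.norm_d_sq]
  linarith [sq_nonneg ‖s.v k‖]

lemma exists_norm_d_le (hr : BoundedRun p f c s X K γ κ) : ∃ D, 0 ≤ D ∧ ∀ k, ‖s.d k‖ ≤ D := by
  obtain ⟨C, hC0, hC⟩ := hr.exists_sqrt_mul_norm_d_le
  have hr0 := sqrt_sigmaMin_pos p
  refine ⟨C / √p.sigmaMin, by positivity, fun k => ?_⟩
  rw [le_div_iff₀ hr0, mul_comm]
  exact (mul_le_mul_of_nonneg_right (hr.sqrt_sigmaMin_le k) (norm_nonneg _)).trans (hC k)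

/-- The residual of the dual condition controls a multiplier through the lower bound on the
singular values. -/
lemma sq_mul_norm_le (hr : BoundedRun p f c s X K γ κ) (k : ℕ) (z : Euc m) :
    γ ^ 2 * ‖z‖ ≤ ‖s.A c k (ContinuousLinearMap.adjoint (s.A c k) z)‖ := by
  have h1 := hr.adjoint_ge k z
  have h2 := hr.mul_norm_le_of_mem_range k
    (y := ContinuousLinearMap.adjoint (s.A c k) z) ⟨z, rfl⟩
  have := hr.prob.γ_pos
  nlinarith

lemma exists_norm_lam_le (hr : BoundedRun p f c s X K γ κ) :
    ∃ Λ, 0 ≤ Λ ∧ ∀ k, ‖s.lam k‖ ≤ Λ := by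
  have hK := hr.prob.K_pos
  have hγ := hr.prob.γ_pos
  have hr0 := sqrt_sigmaMin_pos p
  have hrl := p.rlam_nonneg
  refine ⟨(p.rlam * (1 / √p.sigmaMin) + K * K) / γ ^ 2, by positivity, fun k => ?_⟩
  rw [le_div_iff₀ (by positivity), mul_comm]
  refine (hr.sq_mul_norm_le k _).trans ?_
  have h1 := hr.run.dual k
  have h2 : ‖s.A c k (s.g f k)‖ ≤ K * K :=
    (norm_le_l1 _).trans ((hr.l1_A_le k _).trans (by gcongr; exact hr.norm_g_le k))
  have h3 := mul_le_mul_of_nonneg_left (hr.norm_v_le k) hrl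
  rw [map_add] at h1
  have h4 := norm_sub_le (s.A c k (s.g f k)
    + s.A c k (ContinuousLinearMap.adjoint (s.A c k) (s.lam k))) (s.A c k (s.g f k))
  rw [add_sub_cancel_left] at h4
  linarith

/-- The growth of the model along the normal step, the numerator of `muC`. -/
noncomputable def normalGrowth (f : Euc n → ℝ) (c : Euc n → Euc m) (s : Iterates n m) (k : ℕ) : ℝ :=
  ⟪s.g f k, s.v k⟫ + 1 / 2 * ⟪s.v k, s.H f c k (s.v k)⟫
    + s.sig k / 3 * (‖s.d k‖ ^ 3 - ‖s.u k‖ ^ 3)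

/-- Since `v` and `u` are orthogonal, `‖d‖³ - ‖u‖³` is of order `‖v‖² ‖d‖`; together with
`‖v‖ ≤ 1/√σ` and `‖d‖ = O(1/√σ)` this makes the growth linear in `‖v‖`, uniformly in `σ`. -/
lemma exists_normalGrowth_le (hr : BoundedRun p f c s X K γ κ) :
    ∃ C, 0 ≤ C ∧ ∀ k, normalGrowth f c s k ≤ C * ‖s.v k‖ := by
  obtain ⟨C, hC0, hC⟩ := hr.exists_sqrt_mul_norm_d_le
  have hK := hr.prob.K_pos
  have hκ := hr.κ_pos
  have hr0 := sqrt_sigmaMin_pos p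
  refine ⟨K + κ * (1 / √p.sigmaMin) + C, by positivity, fun k => ?_⟩
  have h1 := real_inner_le_norm (s.g f k) (s.v k)
  have h1' := mul_le_mul_of_nonneg_right (hr.norm_g_le k) (norm_nonneg (s.v k))
  have h2 := (abs_le.1 (hr.abs_inner_H_le k (s.v k))).2
  have h3 : κ * ‖s.v k‖ ^ 2 ≤ κ * (1 / √p.sigmaMin) * ‖s.v k‖ := by
    rw [sq, ← mul_assoc]
    have := hr.norm_v_le k
    gcongr
  have hd := hr.norm_d_sq k
  have hu := hr.norm_u_le_norm_d k
  have h4 := hr.norm_v_mul_sqrt_le k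
  have h5 := hC k
  have hσ := Real.sq_sqrt (hr.sig_pos k).le
  have hσ0 := hr.sqrt_sig_pos k
  have hv0 := norm_nonneg (s.v k)
  have hu0 := norm_nonneg (s.u k)
  have hd0 := norm_nonneg (s.d k)
  have h6 : ‖s.d k‖ ^ 3 - ‖s.u k‖ ^ 3 ≤ 2 * (‖s.v k‖ ^ 2 * ‖s.d k‖) := by
    rw [show ‖s.v k‖ ^ 2 = ‖s.d k‖ ^ 2 - ‖s.u k‖ ^ 2 by linarith]
    nlinarith [mul_nonneg (mul_nonneg (sub_nonneg.2 hu) hd0) hd0,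
      mul_nonneg (mul_nonneg (sub_nonneg.2 hu) hu0) hd0,
      mul_nonneg (mul_nonneg (sub_nonneg.2 hu) hu0) (sub_nonneg.2 hu)]
  have h7 : s.sig k * (‖s.v k‖ ^ 2 * ‖s.d k‖) ≤ C * ‖s.v k‖ := by
    calc s.sig k * (‖s.v k‖ ^ 2 * ‖s.d k‖)
        = (‖s.v k‖ * √(s.sig k)) * (√(s.sig k) * ‖s.d k‖) * ‖s.v k‖ := by
          rw [← hσ]; simp only [Real.sqrt_sq hσ0.le]; ring
      _ ≤ 1 * C * ‖s.v k‖ := by gcongr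
      _ = _ := by ring
  have h8 : s.sig k / 3 * (‖s.d k‖ ^ 3 - ‖s.u k‖ ^ 3) ≤ C * ‖s.v k‖ := by
    have h9 := mul_le_mul_of_nonneg_left h6 (hr.sig_pos k).le
    have : 0 ≤ C * ‖s.v k‖ := by positivity
    linarith
  rw [normalGrowth]
  have : 0 ≤ κ * (1 / √p.sigmaMin) * ‖s.v k‖ := by positivity
  linarith

lemma exists_muC_le (hr : BoundedRun p f c s X K γ κ) : ∃ M, ∀ k, s.muC p f c k ≤ M := by
  obtain ⟨C, hC0, hC⟩ := hr.exists_normalGrowth_le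
  have hγ := hr.prob.γ_pos
  have hq := one_sub_rv_pos p
  refine ⟨C * (2 / γ) / (1 - p.rv - p.tau), fun k => ?_⟩
  have h0 : 0 ≤ C * (2 / γ) / (1 - p.rv - p.tau) := by positivity
  rw [Iterates.muC]
  split_ifs with h
  · exact h0
  · have hc : c (s.x k) ≠ 0 := fun h' => h ((l1_eq_zero_iff _).2 h')
    have hl : 0 < l1 (c (s.x k)) := lt_of_le_of_ne (l1_nonneg _) (Ne.symm h)
    have hb := (hr.bet_mem_Ioc k hc).1
    rw [div_le_iff₀ (by positivity)]
    refine (hC k).trans ?_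
    have h1 := hr.mul_norm_v_le k
    have h2 : ‖s.v k‖ ≤ 2 / γ * (s.bet k * l1 (c (s.x k))) := by
      rw [div_mul_eq_mul_div, le_div_iff₀ hγ]; linarith
    calc C * ‖s.v k‖ ≤ C * (2 / γ * (s.bet k * l1 (c (s.x k)))) := by gcongr
      _ = _ := by field_simp

lemma muInit_le_muPrev_and_le (hr : BoundedRun p f c s X K γ κ) (k : ℕ) :
    p.muInit ≤ s.muPrev p k ∧ s.muPrev p k ≤ s.mu k := by
  have key : ∀ k, p.muInit ≤ s.muPrev p k → s.muPrev p k ≤ s.mu k := by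
    intro k hk
    rw [hr.run.mu_eq k]
    split_ifs with h
    · have := p.muInit_pos
      nlinarith [p.one_lt_nu]
    · exact le_rfl
  induction k with
  | zero => exact ⟨le_rfl, key 0 le_rfl⟩
  | succ k ih =>
    have : p.muInit ≤ s.muPrev p (k + 1) := ih.1.trans ih.2
    exact ⟨this, key _ this⟩

lemma muInit_le_mu (hr : BoundedRun p f c s X K γ κ) (k : ℕ) : p.muInit ≤ s.mu k :=
  (hr.muInit_le_muPrev_and_le k).1.trans (hr.muInit_le_muPrev_and_le k).2

lemma mu_pos (hr : BoundedRun p f c s X K γ κ) (k : ℕ) : 0 < s.mu k :=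
  p.muInit_pos.trans_le (hr.muInit_le_mu k)

lemma muC_le_mu (hr : BoundedRun p f c s X K γ κ) (k : ℕ) : s.muC p f c k ≤ s.mu k := by
  rw [hr.run.mu_eq k]
  split_ifs with h
  · have := p.muInit_pos
    have := (hr.muInit_le_muPrev_and_le k).1
    nlinarith [p.one_lt_nu]
  · exact not_lt.1 h

lemma exists_mu_le (hr : BoundedRun p f c s X K γ κ) : ∃ M, 0 ≤ M ∧ ∀ k, s.mu k ≤ M := by
  obtain ⟨M, hM⟩ := hr.exists_muC_le
  refine ⟨max p.muInit (p.nu * M), p.muInit_pos.le.trans (le_max_left _ _), fun k => ?_⟩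
  induction k with
  | zero =>
    rw [hr.run.mu_eq 0]
    split_ifs with h
    · exact le_trans (by nlinarith [p.one_lt_nu, hM 0]) (le_max_right _ _)
    · exact le_max_left _ _
  | succ k ih =>
    rw [hr.run.mu_eq (k + 1)]
    split_ifs with h
    · exact le_trans (by nlinarith [p.one_lt_nu, hM (k + 1)]) (le_max_right _ _)
    · exact ih

/-- Each increase multiplies the merit parameter by at least `ν > 1`, so a bounded merit parameter
is increased only finitely often. -/
lemma exists_mu_eq (hr : BoundedRun p f c s X K γ κ) :
    ∃ N, ∀ k, N ≤ k → s.mu k = s.mu N := by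
  obtain ⟨M, -, hM⟩ := hr.exists_mu_le
  have hν := p.one_lt_nu
  have hmono : Monotone s.mu := monotone_nat_of_le_succ fun k =>
    (hr.muInit_le_muPrev_and_le (k + 1)).2
  have hstep : ∀ k, s.mu (k + 1) ≠ s.mu k → p.nu * s.mu k ≤ s.mu (k + 1) := by
    intro k hk
    have h := hr.run.mu_eq (k + 1)
    split_ifs at h with h'
    · have h'' : s.mu k < s.muC p f c (k + 1) := h'
      rw [h]; gcongr
    · exact absurd h hk
  obtain ⟨N, hN⟩ : ∃ N, ∀ k, N ≤ k → s.mu (k + 1) = s.mu k := by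
    by_contra! hcon
    have hgrow : ∀ j : ℕ, ∃ k, p.nu ^ j * p.muInit ≤ s.mu k := by
      intro j
      induction j with
      | zero => exact ⟨0, by simpa using hr.muInit_le_mu 0⟩
      | succ j ih =>
        obtain ⟨k, hk⟩ := ih
        obtain ⟨l, hl, hne⟩ := hcon k
        refine ⟨l + 1, le_trans ?_ (hstep l hne)⟩
        rw [pow_succ', mul_assoc]
        exact mul_le_mul_of_nonneg_left (hk.trans (hmono hl)) (by linarith)
    obtain ⟨j, hj⟩ := pow_unbounded_of_one_lt (M / p.muInit) hν
    obtain ⟨k, hk⟩ := hgrow j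
    rw [div_lt_iff₀ p.muInit_pos] at hj
    linarith [hM k]
  refine ⟨N, fun k hk => ?_⟩
  induction k, hk using Nat.le_induction with
  | base => rfl
  | succ k hk ih => rw [hN k hk, ih]

/-! ### The predicted reduction of the merit function -/

lemma normalGrowth_le (hr : BoundedRun p f c s X K γ κ) (k : ℕ) :
    normalGrowth f c s k ≤
      s.mu k * ((1 - p.rv - p.tau) * (s.bet k * l1 (c (s.x k)))) := by
  by_cases hc : c (s.x k) = 0
  · have hv : s.v k = 0 := by simp [Iterates.v, (hr.vc_eq_zero_iff k).2 hc]
    simp [normalGrowth, Iterates.d, hv, hc, l1_zero]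
  · have h1 := hr.muC_le_mu k
    have hl : l1 (c (s.x k)) ≠ 0 := fun h => hc ((l1_eq_zero_iff _).1 h)
    have hl' : 0 < l1 (c (s.x k)) := lt_of_le_of_ne (l1_nonneg _) (Ne.symm hl)
    have hb := (hr.bet_mem_Ioc k hc).1
    have hq := one_sub_rv_pos p
    rw [Iterates.muC, if_neg hl, div_le_iff₀ (by positivity)] at h1
    rw [normalGrowth]
    linarith

/-- The choice of the merit parameter makes the predicted reduction dominate both the reduction of
the reduced model and a multiple of the linearized gain in feasibility. -/
lemma le_deltaQ (hr : BoundedRun p f c s X K γ κ) (k : ℕ) :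
    s.deltaM f c k (s.u k) + p.tau * s.mu k * (s.bet k * l1 (c (s.x k))) ≤ s.deltaQ f c k := by
  have h1 := hr.normalGrowth_le k
  have h2 := mul_le_mul_of_nonneg_left (hr.l1_linearized_le k) (hr.mu_pos k).le
  have e1 : ⟪s.gTilde f c k, s.u k⟫ = ⟪s.g f k, s.u k⟫ + ⟪s.v k, s.H f c k (s.u k)⟫ := by
    rw [gTilde_eq, Iterates.P, inner_nullProj_left, nullProj_eq_self (hr.A_u k), inner_add_left,
      hr.inner_H_comm]
  have e2 : ⟪s.u k, s.H f c k (s.v k)⟫ = ⟪s.v k, s.H f c k (s.u k)⟫ := by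
    rw [real_inner_comm, hr.inner_H_comm]
  have e3 : ⟪s.d k, s.H f c k (s.d k)⟫ = ⟪s.v k, s.H f c k (s.v k)⟫
      + 2 * ⟪s.v k, s.H f c k (s.u k)⟫ + ⟪s.u k, s.H f c k (s.u k)⟫ := by
    rw [Iterates.d, map_add, inner_add_left, inner_add_right, inner_add_right, e2]; ring
  have e4 : ⟪s.g f k, s.d k⟫ = ⟪s.g f k, s.v k⟫ + ⟪s.g f k, s.u k⟫ := by
    rw [Iterates.d, inner_add_right]
  rw [normalGrowth] at h1
  simp only [Iterates.deltaQ, Iterates.q, Iterates.deltaM, Iterates.mU, inner_HTilde, hr.P_u,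
    map_zero, norm_zero, inner_zero_right, add_zero, e1, e3, e4]
  nlinarith

lemma tau_mul_le_deltaQ (hr : BoundedRun p f c s X K γ κ) (k : ℕ) :
    p.tau * p.muInit * (γ / 2) * ‖s.v k‖ ≤ s.deltaQ f c k := by
  have h1 := hr.le_deltaQ k
  have h2 := hr.deltaM_nonneg k
  have h3 := hr.mul_norm_v_le k
  have hτ := p.tau_mem.1
  have hμ := p.muInit_pos
  have h4 := hr.muInit_le_mu k
  have h5 : p.tau * p.muInit * (γ / 2 * ‖s.v k‖)
      ≤ p.tau * s.mu k * (s.bet k * l1 (c (s.x k))) := by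
    have := hr.prob.γ_pos
    have := hr.mu_pos k
    exact mul_le_mul (by gcongr) (by linarith) (by positivity) (by positivity)
  linarith

lemma cube_le_deltaQ (hr : BoundedRun p f c s X K γ κ) (k : ℕ) :
    (1 / 6 - p.delta) * p.sigmaMin * ‖s.u k‖ ^ 3 ≤ s.deltaQ f c k := by
  have h1 := hr.le_deltaQ k
  have h2 := hr.le_deltaM k
  have h3 : 0 ≤ p.tau * s.mu k * (s.bet k * l1 (c (s.x k))) :=
    mul_nonneg (mul_nonneg p.tau_mem.1.le (hr.mu_pos k).le) (hr.bet_mul_l1_nonneg k)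
  have h4 : (1 / 6 - p.delta) * (p.sigmaMin * ‖s.u k‖ ^ 3)
      ≤ (1 / 6 - p.delta) * (s.sig k * ‖s.u k‖ ^ 3) := by
    have := delta_lt p
    have := hr.sigmaMin_le_sig k
    gcongr
  linarith

lemma deltaQ_nonneg (hr : BoundedRun p f c s X K γ κ) (k : ℕ) : 0 ≤ s.deltaQ f c k := by
  refine le_trans ?_ (hr.cube_le_deltaQ k)
  have := delta_lt p
  have := p.sigmaMin_pos
  positivity

lemma q_zero (k : ℕ) : s.q f c k 0 = merit f c (s.x k) (s.mu k) := by
  simp [Iterates.q, merit]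

/-! ### Acceptance of the steps for large regularization -/

lemma exists_merit_trial_le (hr : BoundedRun p f c s X K γ κ) :
    ∃ C, 0 ≤ C ∧ ∀ k, merit f c (s.x k + s.d k) (s.mu k) ≤
      s.q f c k (s.d k) + C * ‖s.d k‖ ^ 2 := by
  obtain ⟨M, hM0, hM⟩ := hr.exists_mu_le
  have hK := hr.prob.K_pos
  have hκ := hr.κ_pos
  refine ⟨K + κ + M * K, by positivity, fun k => ?_⟩
  have hx := hr.dom.iterate_mem k
  have hy := hr.dom.trial_mem k
  have h1 := (abs_le.1 (hr.prob.f_bounds.taylor_one _ hx _ hy)).2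
  have h2 := hr.prob.taylor_one _ hx _ hy
  rw [add_sub_cancel_left] at h1 h2
  have h3 := l1_add_le (c (s.x k + s.d k) - c (s.x k) - jac c (s.x k) (s.d k))
    (c (s.x k) + jac c (s.x k) (s.d k))
  rw [show c (s.x k + s.d k) - c (s.x k) - jac c (s.x k) (s.d k)
    + (c (s.x k) + jac c (s.x k) (s.d k)) = c (s.x k + s.d k) by abel] at h3
  have h4 : s.mu k * l1 (c (s.x k + s.d k)) ≤
      M * (K * ‖s.d k‖ ^ 2) + s.mu k * l1 (c (s.x k) + s.A c k (s.d k)) := by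
    have e1 := mul_le_mul_of_nonneg_left (h3.trans (add_le_add_left h2 _)) (hr.mu_pos k).le
    have e2 : s.mu k * (K * ‖s.d k‖ ^ 2) ≤ M * (K * ‖s.d k‖ ^ 2) := by
      have := hM k
      gcongr
    rw [mul_add] at e1
    exact e1.trans (add_le_add_left e2 _)
  have h5 := (abs_le.1 (hr.abs_inner_H_le k (s.d k))).1
  have h6 : 0 ≤ s.sig k / 3 * ‖s.d k‖ ^ 3 := by
    have := hr.sig_pos k
    positivity
  have h7 : 0 ≤ κ * ‖s.d k‖ ^ 2 := by positivity
  rw [Iterates.q, merit, Iterates.g]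
  linarith

/-- Far from feasibility the normal step has length of order `1/√σ`, so the predicted reduction is
of order `1/√σ`, whereas the model error is of order `‖d‖² = O(1/σ)`. -/
lemma exists_accept_of_not_nearFeasible (hr : BoundedRun p f c s X K γ κ) :
    ∃ S, ∀ k, S ≤ s.sig k → ¬ s.NearFeasible p k → p.eta₁ ≤ s.rho f c k := by
  obtain ⟨C, hC0, hC⟩ := hr.exists_merit_trial_le
  obtain ⟨D, hD0, hD⟩ := hr.exists_sqrt_mul_norm_d_le
  have hη : 0 < 1 - p.eta₁ := by linarith [p.eta₁_lt_eta₂, p.eta₂_lt_one]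
  have hγ := hr.prob.γ_pos
  have hτ := p.tau_mem.1
  have hμ := p.muInit_pos
  have hζ := p.zeta_mem.1
  have hB : 0 < p.tau * p.muInit * (γ / 2) * p.zeta := by positivity
  set B := p.tau * p.muInit * (γ / 2) * p.zeta with hBdef
  refine ⟨(C * D ^ 2 / ((1 - p.eta₁) * B)) ^ 2, fun k hk hnf => ?_⟩
  have hσ0 := hr.sqrt_sig_pos k
  have hσ := Real.sq_sqrt (hr.sig_pos k).le
  have h1 : p.zeta / √(s.sig k) ≤ ‖s.v k‖ := by
    refine le_trans (le_min (not_le.1 hnf).le ?_) (hr.min_le_norm_v k)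
    have := p.zeta_mem.2
    gcongr
  have h2 : B / √(s.sig k) ≤ s.deltaQ f c k := by
    refine le_trans ?_ (hr.tau_mul_le_deltaQ k)
    rw [hBdef, mul_div_assoc]
    gcongr
  have h3 : C * D ^ 2 / ((1 - p.eta₁) * B) ≤ √(s.sig k) := Real.le_sqrt_of_sq_le hk
  have h4 : C * ‖s.d k‖ ^ 2 ≤ (1 - p.eta₁) * s.deltaQ f c k := by
    refine le_trans ?_ (mul_le_mul_of_nonneg_left h2 hη.le)
    have e1 : ‖s.d k‖ ≤ D / √(s.sig k) := by
      rw [le_div_iff₀ hσ0, mul_comm]; exact hD k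
    rw [div_le_iff₀ (by positivity)] at h3
    calc C * ‖s.d k‖ ^ 2 ≤ C * (D / √(s.sig k)) ^ 2 := by gcongr
      _ = C * D ^ 2 / √(s.sig k) / √(s.sig k) := by field_simp
      _ ≤ (√(s.sig k) * ((1 - p.eta₁) * B)) / √(s.sig k) / √(s.sig k) := by gcongr
      _ = _ := by field_simp
  have hq : 0 < s.deltaQ f c k := lt_of_lt_of_le (by positivity) h2
  rw [Iterates.rho, le_div_iff₀ hq]
  have h5 := hC k
  have h6 : s.deltaQ f c k = merit f c (s.x k) (s.mu k) - s.q f c k (s.d k) := by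
    rw [Iterates.deltaQ, q_zero]
  linarith

lemma l1_linearized_le_cube (hr : BoundedRun p f c s X K γ κ) (k : ℕ) (h : s.NearFeasible p k) :
    l1 (c (s.x k) + s.A c k (s.d k)) ≤ ‖s.d k‖ ^ 3 := by
  have h1 : s.A c k (s.d k) = s.A c k (s.vc k) := by
    rw [Iterates.d, map_add, hr.A_u, add_zero, hr.v_eq_vc_of_nearFeasible k h]
  rw [h1, add_comm]
  have h2 := (hr.run.normal k).resid.trans
    (mul_le_mul_of_nonneg_left (min_le_right _ _) p.rv_mem.1)
  have h3 := hr.norm_v_le_norm_d k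
  rw [hr.v_eq_vc_of_nearFeasible k h] at h3
  calc _ ≤ p.rv * ‖s.vc k‖ ^ 3 := h2
    _ ≤ 1 * ‖s.d k‖ ^ 3 := by
      gcongr
      linarith [p.rv_mem.2, p.tau_mem.1]
    _ = _ := one_mul _

lemma exists_l1_trial_le (hr : BoundedRun p f c s X K γ κ) :
    ∃ C, 0 ≤ C ∧ ∀ k, s.NearFeasible p k → l1 (c (s.x k + s.d k)) ≤ C * ‖s.d k‖ ^ 2 := by
  obtain ⟨D, hD0, hD⟩ := hr.exists_norm_d_le
  have hK := hr.prob.K_pos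
  refine ⟨K + D, by positivity, fun k hk => ?_⟩
  have hx := hr.dom.iterate_mem k
  have hy := hr.dom.trial_mem k
  have h2 := hr.prob.taylor_one _ hx _ hy
  rw [add_sub_cancel_left] at h2
  have h3 := l1_add_le (c (s.x k + s.d k) - c (s.x k) - jac c (s.x k) (s.d k))
    (c (s.x k) + jac c (s.x k) (s.d k))
  rw [show c (s.x k + s.d k) - c (s.x k) - jac c (s.x k) (s.d k)
    + (c (s.x k) + jac c (s.x k) (s.d k)) = c (s.x k + s.d k) by abel] at h3
  have h4 : l1 (c (s.x k) + jac c (s.x k) (s.d k)) ≤ ‖s.d k‖ ^ 3 :=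
    hr.l1_linearized_le_cube k hk
  have h5 : ‖s.d k‖ ^ 3 ≤ D * ‖s.d k‖ ^ 2 := by
    rw [pow_succ']
    have := hD k
    gcongr
  linarith

lemma exists_norm_w_le (hr : BoundedRun p f c s X K γ κ) :
    ∃ W, 0 ≤ W ∧ ∀ k, s.Corrects p f c k → ‖s.w k‖ ≤ W * ‖s.d k‖ ^ 2 := by
  obtain ⟨D, hD0, hD⟩ := hr.exists_norm_d_le
  obtain ⟨C, hC0, hC⟩ := hr.exists_l1_trial_le
  have hγ := hr.prob.γ_pos
  have hrw := p.rw_nonneg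
  refine ⟨(C + p.rw * D) / γ, by positivity, fun k hk => ?_⟩
  rw [div_mul_eq_mul_div, le_div_iff₀ hγ, mul_comm]
  refine (hr.mul_norm_le_of_mem_range k (hr.run.corr_mem k hk)).trans ?_
  have h1 := hr.run.corr_resid k hk
  have h2 := norm_sub_le (s.A c k (s.w k) + c (s.x k + s.d k)) (c (s.x k + s.d k))
  rw [add_sub_cancel_right] at h2
  have h3 := (norm_le_l1 _).trans (hC k hk.2)
  have h5 : p.rw * ‖s.d k‖ ^ 3 ≤ p.rw * (D * ‖s.d k‖ ^ 2) := by
    rw [pow_succ']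
    have := hD k
    gcongr
  linarith

/-- The correction removes the second-order part of the constraint violation. -/
lemma exists_l1_corrected_le (hr : BoundedRun p f c s X K γ κ) :
    ∃ C, 0 ≤ C ∧ ∀ k, s.Corrects p f c k →
      l1 (c (s.x k + s.d k + s.w k)) ≤ C * ‖s.d k‖ ^ 3 := by
  obtain ⟨D, hD0, hD⟩ := hr.exists_norm_d_le
  obtain ⟨W, hW0, hW⟩ := hr.exists_norm_w_le
  have hK := hr.prob.K_pos
  have hrw := p.rw_nonneg
  refine ⟨K * (W ^ 2 * D) + K * W + m * p.rw, by positivity, fun k hk => ?_⟩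
  have hx := hr.dom.iterate_mem k
  have hy := hr.dom.trial_mem k
  have hz := hr.dom.corr_mem k hk
  have h1 := hr.prob.taylor_one _ hy _ hz
  have h2 := hr.prob.jac_lip _ hx _ hy (s.w k)
  rw [add_sub_cancel_left] at h1 h2
  have h3 := (l1_le_card_mul_norm _).trans
    (mul_le_mul_of_nonneg_left (hr.run.corr_resid k hk) (Nat.cast_nonneg m))
  have hw := hW k hk
  have hd := hD k
  have e1 : K * ‖s.w k‖ ^ 2 ≤ K * (W ^ 2 * D) * ‖s.d k‖ ^ 3 := by
    calc K * ‖s.w k‖ ^ 2 ≤ K * (W * ‖s.d k‖ ^ 2) ^ 2 := by gcongr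
      _ = K * (W ^ 2 * ‖s.d k‖) * ‖s.d k‖ ^ 3 := by ring
      _ ≤ _ := by gcongr
  have e2 : K * ‖s.d k‖ * ‖s.w k‖ ≤ K * W * ‖s.d k‖ ^ 3 := by
    calc K * ‖s.d k‖ * ‖s.w k‖ ≤ K * ‖s.d k‖ * (W * ‖s.d k‖ ^ 2) := by gcongr
      _ = _ := by ring
  have h4 : c (s.x k + s.d k + s.w k) =
      (c (s.x k + s.d k + s.w k) - c (s.x k + s.d k) - jac c (s.x k + s.d k) (s.w k))
      + (jac c (s.x k + s.d k) (s.w k) - jac c (s.x k) (s.w k))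
      + (s.A c k (s.w k) + c (s.x k + s.d k)) := by
    rw [Iterates.A]; abel
  rw [h4]
  refine (l1_add_le _ _).trans ?_
  refine (add_le_add_left (l1_add_le _ _) _).trans ?_
  linarith

/-- Moving along `w` changes the objective by the curvature of the constraints, weighted by the
multipliers; this turns the Hessian of `f` into that of the Lagrangian. -/
lemma exists_f_corrected_le (hr : BoundedRun p f c s X K γ κ) :
    ∃ C, 0 ≤ C ∧ ∀ k, s.Corrects p f c k →
      f (s.x k + s.d k + s.w k) ≤ f (s.x k) + ⟪s.g f k, s.d k⟫
        + 1 / 2 * ⟪s.d k, s.H f c k (s.d k)⟫ + C * ‖s.d k‖ ^ 3 := by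
  obtain ⟨D, hD0, hD⟩ := hr.exists_norm_d_le
  obtain ⟨W, hW0, hW⟩ := hr.exists_norm_w_le
  obtain ⟨Λ, hΛ0, hΛ⟩ := hr.exists_norm_lam_le
  have hK := hr.prob.K_pos
  have hγ := hr.prob.γ_pos
  have hrw := p.rw_nonneg
  have hrl := p.rlam_nonneg
  refine ⟨K + K * W + K * (W ^ 2 * D) + p.rlam / γ * W + Λ * p.rw + K * Λ + Λ, by positivity,
    fun k hk => ?_⟩
  have hx := hr.dom.iterate_mem k
  have hy := hr.dom.trial_mem k
  have hz := hr.dom.corr_mem k hk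
  have hw := hW k hk
  have hd := hD k
  have hl := hΛ k
  have h1 := (abs_le.1 (hr.prob.f_bounds.taylor_one _ hy _ hz)).2
  have h2 := (abs_le.1 (hr.prob.f_bounds.taylor_two _ hx _ hy)).2
  have h3 := hr.prob.f_bounds.grad_lip _ hx _ hy
  have h4 := (abs_le.1 (hr.prob.taylor_two _ hx _ hy (s.lam k))).2
  rw [add_sub_cancel_left] at h1 h2 h3 h4
  have e1 : K * ‖s.w k‖ ^ 2 ≤ K * (W ^ 2 * D) * ‖s.d k‖ ^ 3 := by
    calc K * ‖s.w k‖ ^ 2 ≤ K * (W * ‖s.d k‖ ^ 2) ^ 2 := by gcongr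
      _ = K * (W ^ 2 * ‖s.d k‖) * ‖s.d k‖ ^ 3 := by ring
      _ ≤ _ := by gcongr
  have e2 : ⟪∇ f (s.x k + s.d k), s.w k⟫ ≤ ⟪s.g f k, s.w k⟫ + K * W * ‖s.d k‖ ^ 3 := by
    have a1 := real_inner_le_norm (∇ f (s.x k + s.d k) - ∇ f (s.x k)) (s.w k)
    have a2 : ‖∇ f (s.x k + s.d k) - ∇ f (s.x k)‖ * ‖s.w k‖
        ≤ K * ‖s.d k‖ * (W * ‖s.d k‖ ^ 2) := by gcongr
    rw [inner_sub_left] at a1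
    rw [Iterates.g]
    linarith
  -- The part of `g + Aᵀλ` seen by `w ∈ range Aᵀ` is bounded by the dual residual.
  have e3 : ⟪s.g f k + ContinuousLinearMap.adjoint (s.A c k) (s.lam k), s.w k⟫
      ≤ p.rlam / γ * W * ‖s.d k‖ ^ 3 := by
    set e := s.g f k + ContinuousLinearMap.adjoint (s.A c k) (s.lam k) with he
    have a1 : ⟪e, s.w k⟫ = ⟪e - nullProj (s.A c k) e, s.w k⟫ := by
      have : ⟪s.w k, nullProj (s.A c k) e⟫ = 0 :=
        inner_eq_zero_of_mem_range_adjoint (hr.run.corr_mem k hk) (apply_nullProj _ _)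
      rw [inner_sub_left, real_inner_comm (s.w k) (nullProj _ _), this, sub_zero]
    have a2 := mul_norm_sub_nullProj_le hγ (hr.adjoint_ge k) e
    have a3 : ‖e - nullProj (s.A c k) e‖ ≤ p.rlam / γ * ‖s.d k‖ := by
      rw [div_mul_eq_mul_div, le_div_iff₀ hγ, mul_comm]
      exact a2.trans ((hr.run.dual k).trans
        (mul_le_mul_of_nonneg_left (hr.norm_v_le_norm_d k) hrl))
    rw [a1]
    calc _ ≤ _ := real_inner_le_norm _ _
      _ ≤ p.rlam / γ * ‖s.d k‖ * (W * ‖s.d k‖ ^ 2) := by gcongr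
      _ = _ := by ring
  rw [inner_add_left, ContinuousLinearMap.adjoint_inner_left] at e3
  have e4 : |⟪s.lam k, s.A c k (s.w k) + c (s.x k + s.d k)⟫| ≤ Λ * p.rw * ‖s.d k‖ ^ 3 := by
    calc _ ≤ _ := abs_real_inner_le_norm _ _
      _ ≤ Λ * (p.rw * ‖s.d k‖ ^ 3) := by
        have := hr.run.corr_resid k hk
        gcongr
      _ = _ := by ring
  have e5 : ⟪s.lam k, c (s.x k) + s.A c k (s.d k)⟫ ≤ Λ * ‖s.d k‖ ^ 3 := by
    calc _ ≤ _ := real_inner_le_norm _ _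
      _ ≤ Λ * ‖s.d k‖ ^ 3 := by
        have := (norm_le_l1 _).trans (hr.l1_linearized_le_cube k hk.2)
        gcongr
  have e6 : K * ‖s.lam k‖ * ‖s.d k‖ ^ 3 ≤ K * Λ * ‖s.d k‖ ^ 3 := by gcongr
  have e7 : ⟪s.lam k, c (s.x k + s.d k) - c (s.x k) - jac c (s.x k) (s.d k)⟫
      = ⟪s.lam k, c (s.x k + s.d k)⟫ - ⟪s.lam k, c (s.x k) + s.A c k (s.d k)⟫ := by
    rw [← inner_sub_right, Iterates.A, sub_sub]
  have e8 : ⟪s.d k, s.H f c k (s.d k)⟫ = ⟪s.d k, hess f (s.x k) (s.d k)⟫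
      + ⟪s.d k, (∑ i, s.lam k i • hess (con c i) (s.x k)) (s.d k)⟫ := by
    rw [Iterates.H, hessLagrangian, add_apply, inner_add_right]
  rw [e7] at h4
  rw [inner_add_right] at e4
  rw [e8]
  have e9 := (abs_le.1 e4).1
  rw [Iterates.g] at e2 e3 ⊢
  linarith

/-- Near feasibility the corrected step is modelled up to an error of order `‖d‖³`, which the cubic
regularization term absorbs once `σ` is large. -/
lemma exists_successful_of_nearFeasible (hr : BoundedRun p f c s X K γ κ) :
    ∃ S, ∀ k, S ≤ s.sig k → s.NearFeasible p k → 0 < s.deltaQ f c k →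
      s.Successful p f c k := by
  obtain ⟨M, hM0, hM⟩ := hr.exists_mu_le
  obtain ⟨C, hC0, hC⟩ := hr.exists_l1_corrected_le
  obtain ⟨F, hF0, hF⟩ := hr.exists_f_corrected_le
  refine ⟨3 * (F + M * C), fun k hk hnf hq => ?_⟩
  by_cases hρ : p.eta₁ ≤ s.rho f c k
  · exact Or.inl hρ
  have hcorr : s.Corrects p f c k := ⟨not_le.1 hρ, hnf⟩
  refine Or.inr ⟨hcorr, ?_⟩
  rw [Iterates.rhoCorr, le_div_iff₀ hq]
  have h1 := hC k hcorr
  have h2 := hF k hcorr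
  have h3 : s.mu k * l1 (c (s.x k + s.d k + s.w k)) ≤ M * (C * ‖s.d k‖ ^ 3) := by
    have := hM k
    exact mul_le_mul this h1 (l1_nonneg _) hM0
  have h4 : (F + M * C) * ‖s.d k‖ ^ 3 ≤ s.sig k / 3 * ‖s.d k‖ ^ 3 := by
    gcongr; linarith
  have h5 : 0 ≤ s.mu k * l1 (c (s.x k) + s.A c k (s.d k)) :=
    mul_nonneg (hr.mu_pos k).le (l1_nonneg _)
  have h6 : s.deltaQ f c k = merit f c (s.x k) (s.mu k) - s.q f c k (s.d k) := by
    rw [Iterates.deltaQ, q_zero]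
  have h7 : merit f c (s.x k + s.d k + s.w k) (s.mu k) ≤ s.q f c k (s.d k) := by
    rw [merit, Iterates.q]; linarith
  have h8 : p.eta₁ * s.deltaQ f c k ≤ 1 * s.deltaQ f c k := by
    gcongr; linarith [p.eta₁_lt_eta₂, p.eta₂_lt_one]
  linarith

/-- Unless the predicted reduction vanishes at some iteration, the regularization parameter stays
bounded. -/
lemma exists_sig_le (hr : BoundedRun p f c s X K γ κ) (hq : ∀ k, 0 < s.deltaQ f c k) :
    ∃ S, ∀ k, s.sig k ≤ S := by
  obtain ⟨S₁, h1⟩ := hr.exists_accept_of_not_nearFeasible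
  obtain ⟨S₂, h2⟩ := hr.exists_successful_of_nearFeasible
  have hg : 0 < p.gam₂ := by linarith [p.one_lt_gam₁, p.gam₁_lt_gam₂]
  refine ⟨max (s.sig 0) (p.gam₂ * max S₁ S₂), fun k => ?_⟩
  induction k with
  | zero => exact le_max_left _ _
  | succ k ih =>
    by_cases hs : s.Successful p f c k
    · by_cases hv : s.VerySuccessful p f c k
      · exact (hr.run.sig_very k hv).2.trans ih
      · rw [hr.run.sig_succ k hs hv]; exact ih
    · refine (hr.run.sig_unsucc k hs).2.trans (le_trans ?_ (le_max_right _ _))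
      gcongr
      by_contra! hlt
      refine hs ?_
      by_cases hnf : s.NearFeasible p k
      · exact h2 k ((le_max_right _ _).trans hlt.le) hnf (hq k)
      · exact Or.inl (h1 k ((le_max_left _ _).trans hlt.le) hnf)

/-! ### Short steps mean near stationarity -/

/-- The iterate `x_k` satisfies the second-order conditions up to `ε`. The first-order part is
stated for the projected gradient `P_k g_k`, which depends only on `x_k` and not on the multiplier. -/
structure NearStationary (f : Euc n → ℝ) (c : Euc n → Euc m) (s : Iterates n m) (k : ℕ) (ε : ℝ) :
    Prop where
  l1_le : l1 (c (s.x k)) ≤ ε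
  norm_P_g_le : ‖s.P c k (s.g f k)‖ ≤ ε
  curv : ∀ y, s.A c k y = 0 → -ε * ‖y‖ ^ 2 ≤ ⟪y, s.H f c k y⟫

lemma NearStationary.mono {k : ℕ} {ε ε' : ℝ} (h : NearStationary f c s k ε) (hε : ε ≤ ε') :
    NearStationary f c s k ε' where
  l1_le := h.l1_le.trans hε
  norm_P_g_le := h.norm_P_g_le.trans hε
  curv y hy := le_trans (by gcongr) (h.curv y hy)

lemma nearStationary_of_norm_le (hr : BoundedRun p f c s X K γ κ) {k : ℕ} {S t : ℝ}
    (hS : s.sig k ≤ S) (ht0 : 0 ≤ t) (ht1 : t ≤ 1) (htS : t < p.theta / √S)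
    (hv : ‖s.v k‖ ≤ t) (hu : ‖s.u k‖ ≤ t) :
    NearStationary f c s k ((K / (1 - p.rv) + 2 * κ + 2 * S) * t) := by
  have hK := hr.prob.K_pos
  have hκ := hr.κ_pos
  have hσ := hr.sig_pos k
  have hS0 : 0 < S := hσ.trans_le hS
  have hrv : 0 < 1 - p.rv := by linarith [one_sub_rv_pos p, p.tau_mem.1]
  have hu0 := norm_nonneg (s.u k)
  have hA : 0 ≤ K / (1 - p.rv) * t := by positivity
  have hB : 0 ≤ κ * t := by positivity
  have hC : 0 ≤ S * t := by positivity
  refine ⟨?_, ?_, fun y hy => ?_⟩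
  · have h1 : ‖s.vc k‖ ≤ t := by
      have h2 : p.theta / √S ≤ p.theta / √(s.sig k) := by
        have := hr.sqrt_sig_pos k
        have := p.theta_mem.1
        gcongr
      rcases min_le_iff.1 ((hr.min_le_norm_v k).trans hv) with h | h
      · exact h
      · exact absurd (h2.trans h) (not_le.2 htS)
    have h3 := (hr.l1_le_norm_vc k).trans (mul_le_mul_of_nonneg_left h1 hK.le)
    have h4 : l1 (c (s.x k)) ≤ K / (1 - p.rv) * t := by
      rw [div_mul_eq_mul_div, le_div_iff₀ hrv]; linarith
    linarith
  · have h1 := hr.norm_P_g_le k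
    have h2 : s.sig k * ‖s.u k‖ ^ 2 ≤ S * t := by
      have : ‖s.u k‖ ^ 2 ≤ t := by nlinarith
      gcongr
    have h3 : κ * ‖s.v k‖ ≤ κ * t := by gcongr
    have h4 : κ * ‖s.u k‖ ≤ κ * t := by gcongr
    linarith
  · refine le_trans ?_ (hr.neg_mul_le_inner_H k hy)
    have h1 : s.sig k * ‖s.u k‖ ≤ S * t := by gcongr
    refine mul_le_mul_of_nonneg_right ?_ (by positivity)
    linarith

lemma exists_deltaQ_small (hr : BoundedRun p f c s X K γ κ) {t : ℝ} (ht : 0 < t) :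
    ∃ η, 0 < η ∧ ∀ k, s.deltaQ f c k ≤ η → ‖s.v k‖ ≤ t ∧ ‖s.u k‖ ≤ t := by
  have hγ := hr.prob.γ_pos
  have hτ := p.tau_mem.1
  have hμ := p.muInit_pos
  have hδ := delta_lt p
  have hs := p.sigmaMin_pos
  refine ⟨min (p.tau * p.muInit * (γ / 2) * t) ((1 / 6 - p.delta) * p.sigmaMin * t ^ 3),
    lt_min (by positivity) (by positivity), fun k hk => ⟨?_, ?_⟩⟩
  · exact le_of_mul_le_mul_left
      ((hr.tau_mul_le_deltaQ k).trans (hk.trans (min_le_left _ _))) (by positivity)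
  · have h1 : ‖s.u k‖ ^ 3 ≤ t ^ 3 := le_of_mul_le_mul_left
      ((hr.cube_le_deltaQ k).trans (hk.trans (min_le_right _ _))) (by positivity)
    exact le_of_pow_le_pow_left₀ (by norm_num) ht.le h1

/-! ### Vanishing predicted reduction -/

lemma steps_eq_zero_of_deltaQ_eq_zero (hr : BoundedRun p f c s X K γ κ) {k : ℕ}
    (h : s.deltaQ f c k = 0) : s.v k = 0 ∧ s.u k = 0 := by
  have key : ∀ t, 0 < t → ‖s.v k‖ ≤ t ∧ ‖s.u k‖ ≤ t := fun t ht => by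
    obtain ⟨η, hη, hq⟩ := hr.exists_deltaQ_small ht
    exact hq k (h.le.trans hη.le)
  exact ⟨norm_le_zero_iff.1 (le_of_forall_pos_le_add fun t ht => by simpa using (key t ht).1),
    norm_le_zero_iff.1 (le_of_forall_pos_le_add fun t ht => by simpa using (key t ht).2)⟩

lemma nearStationary_zero (hr : BoundedRun p f c s X K γ κ) {k : ℕ}
    (h : s.deltaQ f c k = 0) : NearStationary f c s k 0 := by
  obtain ⟨hv, hu⟩ := hr.steps_eq_zero_of_deltaQ_eq_zero h
  have hθ := p.theta_mem.1
  have hσ := hr.sqrt_sig_pos k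
  have := hr.nearStationary_of_norm_le (k := k) le_rfl le_rfl zero_le_one
    (by positivity) (by simp [hv]) (by simp [hu])
  rwa [mul_zero] at this

lemma not_successful_of_deltaQ_eq_zero {k : ℕ} (h : s.deltaQ f c k = 0) :
    ¬ s.Successful p f c k := by
  have := p.eta₁_pos
  rintro (h1 | ⟨-, h1⟩)
  · rw [Iterates.rho, h, div_zero] at h1; linarith
  · rw [Iterates.rhoCorr, h, div_zero] at h1; linarith

/-- Once the predicted reduction vanishes, the multiplier is determined by `x_k`, so the next
iteration faces the same reduced model, whose minimizer is zero. -/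
lemma deltaQ_succ_eq_zero (hr : BoundedRun p f c s X K γ κ) {k : ℕ}
    (h : s.deltaQ f c k = 0) : s.x (k + 1) = s.x k ∧ s.deltaQ f c (k + 1) = 0 := by
  have hx := hr.run.x_reject k (not_successful_of_deltaQ_eq_zero h)
  have hst := hr.nearStationary_zero h
  obtain ⟨hv, -⟩ := hr.steps_eq_zero_of_deltaQ_eq_zero h
  have hc : c (s.x k) = 0 := (l1_eq_zero_iff _).1 (le_antisymm hst.l1_le (l1_nonneg _))
  have hA : s.A c (k + 1) = s.A c k := by rw [Iterates.A, Iterates.A, hx]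
  have hg : s.g f (k + 1) = s.g f k := by rw [Iterates.g, Iterates.g, hx]
  have hv' : s.v (k + 1) = 0 := by
    rw [Iterates.v, (hr.vc_eq_zero_iff (k + 1)).2 (by rw [hx, hc]), smul_zero]
  have hlam : s.lam (k + 1) = s.lam k := by
    have h1 := hr.run.dual k
    have h2 := hr.run.dual (k + 1)
    rw [hA, hg, hv', norm_zero, mul_zero] at h2
    rw [hv, norm_zero, mul_zero] at h1
    have h3 := norm_le_zero_iff.1 h1
    have h4 := norm_le_zero_iff.1 h2
    have h5 := hr.sq_mul_norm_le k (s.lam (k + 1) - s.lam k)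
    rw [map_add] at h3 h4
    rw [map_sub, map_sub, add_left_cancel (h4.trans h3.symm), sub_self, norm_zero] at h5
    have hγ := hr.prob.γ_pos
    have h6 : ‖s.lam (k + 1) - s.lam k‖ ≤ 0 := by
      by_contra! h7
      have : 0 < γ ^ 2 * ‖s.lam (k + 1) - s.lam k‖ := by positivity
      linarith
    exact sub_eq_zero.1 (norm_le_zero_iff.1 h6)
  have hH : s.H f c (k + 1) = s.H f c k := by rw [Iterates.H, Iterates.H, hx, hlam]
  have hgt : s.gTilde f c (k + 1) = 0 := by
    rw [gTilde_eq, hv', map_zero, add_zero, hg, Iterates.P, hA]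
    exact norm_le_zero_iff.1 hst.norm_P_g_le
  have hu' : s.u (k + 1) = 0 := by
    have h1 := hr.le_deltaM (k + 1)
    have h2 := hst.curv (s.u (k + 1)) (by rw [← hA]; exact hr.A_u (k + 1))
    simp only [Iterates.deltaM, Iterates.mU, inner_HTilde, hr.P_u, map_zero, norm_zero,
      inner_zero_right, hgt, inner_zero_left, hH] at h1
    by_contra hne
    have h3 : 0 < ‖s.u (k + 1)‖ := norm_pos_iff.2 hne
    have h4 := hr.sig_pos (k + 1)
    have h5 := delta_lt p
    have h6 : 0 < (1 / 6 - p.delta) * (s.sig (k + 1) * ‖s.u (k + 1)‖ ^ 3) := by positivity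
    have h7 : 0 < s.sig (k + 1) / 3 * ‖s.u (k + 1)‖ ^ 3 := by positivity
    linarith
  refine ⟨hx, ?_⟩
  rw [Iterates.deltaQ, Iterates.d, hv', hu', add_zero, sub_self]

lemma nearStationary_of_exists_deltaQ_eq_zero (hr : BoundedRun p f c s X K γ κ)
    (h : ∃ k, s.deltaQ f c k = 0) : ∀ᶠ k in atTop, NearStationary f c s k 0 := by
  obtain ⟨N, hN⟩ := h
  refine eventually_atTop.2 ⟨N, fun k hk => hr.nearStationary_zero ?_⟩
  induction k, hk using Nat.le_induction with
  | base => exact hN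
  | succ k hk ih => exact (hr.deltaQ_succ_eq_zero ih).2

/-! ### Positive predicted reduction -/

lemma eta_mul_deltaQ_le (hr : BoundedRun p f c s X K γ κ) {k : ℕ} (hq : 0 < s.deltaQ f c k)
    (hs : s.Successful p f c k) : p.eta₁ * s.deltaQ f c k ≤
      merit f c (s.x k) (s.mu k) - merit f c (s.x (k + 1)) (s.mu k) := by
  rcases hs with h | ⟨hc, h⟩
  · rw [hr.run.x_accept k h]
    rwa [Iterates.rho, le_div_iff₀ hq] at h
  · rw [hr.run.x_correct k hc h]
    rwa [Iterates.rhoCorr, le_div_iff₀ hq] at h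

/-- The merit function with the final merit parameter decreases and is bounded below, so the
predicted reductions of successful iterations tend to zero. -/
lemma eventually_deltaQ_le (hr : BoundedRun p f c s X K γ κ) (hq : ∀ k, 0 < s.deltaQ f c k)
    {ε : ℝ} (hε : 0 < ε) :
    ∀ᶠ k in atTop, s.Successful p f c k → s.deltaQ f c k ≤ ε := by
  obtain ⟨N, hN⟩ := hr.exists_mu_eq
  have hη := p.eta₁_pos
  set φ : ℕ → ℝ := fun j => merit f c (s.x (N + j)) (s.mu N) with hφ
  have hdec : ∀ j, s.Successful p f c (N + j) →
      p.eta₁ * s.deltaQ f c (N + j) ≤ φ j - φ (j + 1) := by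
    intro j hs
    have := hr.eta_mul_deltaQ_le (hq _) hs
    rwa [hN _ (Nat.le_add_right N j)] at this
  have hanti : Antitone φ := antitone_nat_of_succ_le fun j => by
    by_cases hs : s.Successful p f c (N + j)
    · have := hdec j hs
      have := hq (N + j)
      have : 0 < p.eta₁ * s.deltaQ f c (N + j) := by positivity
      linarith
    · have := hr.run.x_reject _ hs
      simp only [hφ]
      rw [← add_assoc, this]
  have hbdd : BddBelow (range φ) := by
    refine ⟨-K, ?_⟩
    rintro _ ⟨j, rfl⟩
    have h1 := (abs_le.1 (hr.prob.f_bounds.abs_le _ (hr.dom.iterate_mem (N + j)))).1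
    have h2 := mul_nonneg (hr.mu_pos N).le (l1_nonneg (c (s.x (N + j))))
    simp only [hφ, merit]
    linarith
  have hlim := tendsto_atTop_ciInf hanti hbdd
  have hdiff : Tendsto (fun j => φ j - φ (j + 1)) atTop (𝓝 0) := by
    simpa using hlim.sub (hlim.comp (tendsto_add_atTop_nat 1))
  have hev := hdiff.eventually (gt_mem_nhds (show 0 < p.eta₁ * ε by positivity))
  obtain ⟨J, hJ⟩ := eventually_atTop.1 hev
  refine eventually_atTop.2 ⟨N + J, fun k hk hs => ?_⟩
  obtain ⟨j, rfl⟩ := Nat.exists_eq_add_of_le (le_trans (Nat.le_add_right N J) hk)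
  have h1 := hdec j hs
  have h2 := hJ j (by omega)
  exact le_of_mul_le_mul_left (h1.trans h2.le) hη

/-- With bounded regularization parameter, every run of unsuccessful iterations ends; the iterate
does not move during it. -/
lemma exists_successful_ge (hr : BoundedRun p f c s X K γ κ) (hq : ∀ k, 0 < s.deltaQ f c k)
    (k : ℕ) : ∃ l, k ≤ l ∧ s.x l = s.x k ∧ s.Successful p f c l := by
  obtain ⟨S, hS⟩ := hr.exists_sig_le hq
  by_contra! hcon
  have hx : ∀ j, s.x (k + j) = s.x k := by
    intro j
    induction j with
    | zero => rfl
    | succ j ih =>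
      rw [← add_assoc, hr.run.x_reject _ (hcon _ (Nat.le_add_right k j) ih), ih]
  have hgrow : ∀ j : ℕ, p.gam₁ ^ j * s.sig k ≤ s.sig (k + j) := by
    intro j
    induction j with
    | zero => simp
    | succ j ih =>
      have h1 := (hr.run.sig_unsucc _ (hcon _ (Nat.le_add_right k j) (hx j))).1
      rw [pow_succ', mul_assoc]
      exact (mul_le_mul_of_nonneg_left ih (by linarith [p.one_lt_gam₁])).trans h1
  obtain ⟨j, hj⟩ := pow_unbounded_of_one_lt (S / s.sig k) p.one_lt_gam₁
  rw [div_lt_iff₀ (hr.sig_pos k)] at hj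
  linarith [hgrow j, hS (k + j)]

/-- Every late iterate coincides with one at which the second-order conditions hold up to `ε`. The
index may change because the multiplier, and with it `H_k`, changes in unsuccessful iterations. -/
lemma eventually_exists_nearStationary (hr : BoundedRun p f c s X K γ κ) {ε : ℝ} (hε : 0 < ε) :
    ∀ᶠ k in atTop, ∃ l, s.x l = s.x k ∧ NearStationary f c s l ε := by
  by_cases h : ∃ k, s.deltaQ f c k = 0
  · filter_upwards [hr.nearStationary_of_exists_deltaQ_eq_zero h] with k hk
    exact ⟨k, rfl, hk.mono hε.le⟩
  have hq : ∀ k, 0 < s.deltaQ f c k := fun k =>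
    lt_of_le_of_ne (hr.deltaQ_nonneg k) fun h' => h ⟨k, h'.symm⟩
  obtain ⟨S, hS⟩ := hr.exists_sig_le hq
  have hK := hr.prob.K_pos
  have hκ := hr.κ_pos
  have hS0 : 0 < S := (hr.sig_pos 0).trans_le (hS 0)
  have hrv : 0 < 1 - p.rv := by linarith [one_sub_rv_pos p, p.tau_mem.1]
  have hθ := p.theta_mem.1
  have hC : 0 < K / (1 - p.rv) + 2 * κ + 2 * S := by positivity
  set C := K / (1 - p.rv) + 2 * κ + 2 * S with hCdef
  have hsS : 0 < √S := Real.sqrt_pos.2 hS0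
  have ht : 0 < min (min 1 (p.theta / √S / 2)) (ε / C) :=
    lt_min (lt_min one_pos (by positivity)) (by positivity)
  set t := min (min 1 (p.theta / √S / 2)) (ε / C) with htdef
  obtain ⟨η, hη, hsmall⟩ := hr.exists_deltaQ_small ht
  obtain ⟨N, hN⟩ := eventually_atTop.1 (hr.eventually_deltaQ_le hq hη)
  refine eventually_atTop.2 ⟨N, fun k hk => ?_⟩
  obtain ⟨l, hkl, hxl, hsl⟩ := hr.exists_successful_ge hq k
  refine ⟨l, hxl, ?_⟩
  obtain ⟨hv, hu⟩ := hsmall l (hN l (hk.trans hkl) hsl)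
  have h1 : t ≤ 1 := (min_le_left _ _).trans (min_le_left _ _)
  have h2 : t < p.theta / √S := by
    have : t ≤ p.theta / √S / 2 := (min_le_left _ _).trans (min_le_right _ _)
    have : 0 < p.theta / √S := by positivity
    linarith
  refine (hr.nearStationary_of_norm_le (hS l) ht.le h1 h2 hv hu).mono ?_
  have h3 : t ≤ ε / C := min_le_right _ _
  rw [le_div_iff₀ hC] at h3
  linarith

/-! ### Stationarity with the multipliers of the run -/

/-- Two iterations at the same point have multipliers, hence Hessians, that differ by a multiple of
the dual residuals, so near stationarity passes from one to the other. -/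
lemma exists_nearStationary_transfer (hr : BoundedRun p f c s X K γ κ) :
    ∃ C, 0 < C ∧ ∀ k l ε, s.x l = s.x k → NearStationary f c s l ε →
      ‖gradLagrangian f c (s.x k) (s.lam k)‖ ≤ C * ε ∧ l1 (c (s.x k)) ≤ C * ε ∧
      ∀ y, jac c (s.x k) y = 0 →
        -(C * ε) * ‖y‖ ^ 2 ≤ ⟪y, hessLagrangian f c (s.x k) (s.lam k) y⟫ := by
  have hK := hr.prob.K_pos
  have hγ := hr.prob.γ_pos
  have hrl := p.rlam_nonneg
  refine ⟨1 + p.rlam * (2 / γ) / γ + K * (p.rlam * (4 / γ) / γ ^ 2), by positivity,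
    fun k l ε hx hst => ?_⟩
  have hA : s.A c l = s.A c k := by rw [Iterates.A, Iterates.A, hx]
  have hg : s.g f l = s.g f k := by rw [Iterates.g, Iterates.g, hx]
  have hε : 0 ≤ ε := (l1_nonneg _).trans hst.l1_le
  have hc : l1 (c (s.x k)) ≤ ε := hx ▸ hst.l1_le
  have hv : ∀ j, l1 (c (s.x j)) ≤ ε → p.rlam * ‖s.v j‖ ≤ p.rlam * (2 / γ) * ε := by
    intro j hj
    have h1 := hr.mul_norm_vc_le j
    have h2 := hr.norm_v_le_norm_vc j
    have h3 : ‖s.v j‖ ≤ 2 / γ * ε := by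
      rw [div_mul_eq_mul_div, le_div_iff₀ hγ]
      nlinarith
    rw [mul_assoc]
    gcongr
  have dk := (hr.run.dual k).trans (hv k hc)
  have dl := (hr.run.dual l).trans (hv l hst.l1_le)
  rw [hA, hg] at dl
  have t1 : 0 ≤ p.rlam * (2 / γ) / γ * ε := by positivity
  have t2 : 0 ≤ K * (p.rlam * (4 / γ) / γ ^ 2) * ε := by positivity
  refine ⟨?_, by linarith, fun y hy => ?_⟩
  · have hxX := hr.dom.iterate_mem k
    rw [gradLagrangian_eq ((hr.prob.f_bounds.contDiffAt _ hxX).differentiableAt (by norm_num))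
      (hr.prob.diff_c _ hxX)]
    set e := ∇ f (s.x k) + ContinuousLinearMap.adjoint (jac c (s.x k)) (s.lam k) with he
    have h1 : ‖e - nullProj (s.A c k) e‖ ≤ p.rlam * (2 / γ) / γ * ε := by
      rw [div_mul_eq_mul_div, le_div_iff₀ hγ, mul_comm]
      exact (mul_norm_sub_nullProj_le hγ (hr.adjoint_ge k) e).trans dk
    have h2 : ‖nullProj (s.A c k) e‖ ≤ ε := by
      have h3 := hst.norm_P_g_le
      rw [Iterates.P, hA, hg] at h3
      rw [he, map_add, Iterates.A, nullProj_adjoint, add_zero]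
      exact h3
    have h3 := norm_add_le (e - nullProj (s.A c k) e) (nullProj (s.A c k) e)
    rw [sub_add_cancel] at h3
    linarith
  · have h1 := hst.curv y (by rw [hA]; exact hy)
    have h2 : ‖s.lam k - s.lam l‖ ≤ p.rlam * (4 / γ) / γ ^ 2 * ε := by
      rw [div_mul_eq_mul_div, le_div_iff₀ (by positivity), mul_comm]
      refine (hr.sq_mul_norm_le k _).trans ?_
      have h3 := norm_sub_le
        (s.A c k (s.g f k + ContinuousLinearMap.adjoint (s.A c k) (s.lam k)))
        (s.A c k (s.g f k + ContinuousLinearMap.adjoint (s.A c k) (s.lam l)))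
      rw [← map_sub, add_sub_add_left_eq_sub, ← map_sub] at h3
      refine h3.trans ((add_le_add dk dl).trans (le_of_eq ?_))
      ring
    have h3 : hessLagrangian f c (s.x k) (s.lam k) =
        s.H f c l + ∑ i, (s.lam k - s.lam l) i • hess (con c i) (s.x k) := by
      have h4 : ∀ i, (s.lam k - s.lam l) i • hess (con c i) (s.x k)
          = s.lam k i • hess (con c i) (s.x k) - s.lam l i • hess (con c i) (s.x k) :=
        fun i => sub_smul (s.lam k i : ℝ) (s.lam l i : ℝ) (hess (con c i) (s.x k))
      rw [Iterates.H, hessLagrangian, hessLagrangian, hx, Finset.sum_congr rfl fun i _ => h4 i,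
        Finset.sum_sub_distrib]
      abel
    have h4 := hr.prob.hess_le _ (hr.dom.iterate_mem k) (s.lam k - s.lam l)
    rw [h3, add_apply, inner_add_right]
    set E := ∑ i, (s.lam k - s.lam l) i • hess (con c i) (s.x k)
    have h5 := (abs_le.1 (abs_real_inner_le_norm y (E y))).1
    have h6 := E.le_of_opNorm_le h4 y
    have h7 : ‖y‖ * ‖E y‖ ≤ K * (p.rlam * (4 / γ) / γ ^ 2) * ε * ‖y‖ ^ 2 := by
      calc ‖y‖ * ‖E y‖ ≤ ‖y‖ * (K * (p.rlam * (4 / γ) / γ ^ 2 * ε) * ‖y‖) := by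
            gcongr
            exact h6.trans (by gcongr)
        _ = _ := by ring
    have h8 : 0 ≤ p.rlam * (2 / γ) / γ * ε * ‖y‖ ^ 2 := by positivity
    linarith

lemma eventually_stationary (hr : BoundedRun p f c s X K γ κ) {ε : ℝ} (hε : 0 < ε) :
    ∀ᶠ k in atTop, ‖gradLagrangian f c (s.x k) (s.lam k)‖ ≤ ε ∧ l1 (c (s.x k)) ≤ ε ∧
      ∀ y, jac c (s.x k) y = 0 →
        -ε * ‖y‖ ^ 2 ≤ ⟪y, hessLagrangian f c (s.x k) (s.lam k) y⟫ := by
  obtain ⟨C, hC, h⟩ := hr.exists_nearStationary_transfer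
  filter_upwards [hr.eventually_exists_nearStationary (show 0 < ε / C by positivity)] with k hk
  obtain ⟨l, hx, hl⟩ := hk
  have := h k l _ hx hl
  rwa [mul_div_cancel₀ _ hC.ne'] at this

/-! ### Limit points -/

lemma tendsto_clm_apply {E F : Type*} [NormedAddCommGroup E] [NormedSpace ℝ E]
    [NormedAddCommGroup F] [NormedSpace ℝ F] {T : ℕ → E →L[ℝ] F} {T₀ : E →L[ℝ] F} {y : ℕ → E}
    {y₀ : E} (hT : Tendsto T atTop (𝓝 T₀)) (hy : Tendsto y atTop (𝓝 y₀)) :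
    Tendsto (fun j => T j (y j)) atTop (𝓝 (T₀ y₀)) :=
  (isBoundedBilinearMap_apply.continuous.tendsto (T₀, y₀)).comp (hT.prodMk_nhds hy)

lemma isSOSP_of_mapClusterPt (hr : BoundedRun p f c s X K γ κ) {xbar : Euc n}
    (hcl : MapClusterPt xbar atTop s.x) (hf : ContDiffAt ℝ 2 f xbar)
    (hc : ContDiffAt ℝ 2 c xbar) : IsSOSP f c 0 0 0 xbar := by
  have hγ := hr.prob.γ_pos
  obtain ⟨φ, hφ, hxφ⟩ := hcl.tendsto_subseq
  obtain ⟨Λ, -, hΛ⟩ := hr.exists_norm_lam_le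
  obtain ⟨lam, -, ψ, hψ, hlψ⟩ := (isCompact_closedBall (0 : Euc m) Λ).tendsto_subseq
    (x := s.lam ∘ φ) (fun j => by simpa using hΛ (φ j))
  set χ := φ ∘ ψ with hχ
  have hχt : Tendsto χ atTop atTop := hφ.tendsto_atTop.comp hψ.tendsto_atTop
  have hx : Tendsto (fun j => s.x (χ j)) atTop (𝓝 xbar) := hxφ.comp hψ.tendsto_atTop
  have hl : Tendsto (fun j => s.lam (χ j)) atTop (𝓝 lam) := hlψ
  have hev := fun (ε : ℝ) (hε : 0 < ε) => hχt.eventually (hr.eventually_stationary hε)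
  have hJ : Tendsto (fun j => jac c (s.x (χ j))) atTop (𝓝 (jac c xbar)) :=
    ((hc.fderiv_right (m := 0) (by norm_num)).continuousAt.tendsto).comp hx
  have hgL : Tendsto (fun j => gradLagrangian f c (s.x (χ j)) (s.lam (χ j))) atTop
      (𝓝 (gradLagrangian f c xbar lam)) := by
    rw [gradLagrangian_eq (hf.differentiableAt (by norm_num)) (hc.differentiableAt (by norm_num))]
    have h1 : Tendsto (fun j => ∇ f (s.x (χ j))) atTop (𝓝 (∇ f xbar)) :=
      (contDiffAt_gradient hf).continuousAt.tendsto.comp hx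
    have h2 : Tendsto (fun j => ContinuousLinearMap.adjoint (jac c (s.x (χ j)))) atTop
        (𝓝 (ContinuousLinearMap.adjoint (jac c xbar))) :=
      (ContinuousLinearMap.adjoint.continuous.tendsto _).comp hJ
    refine (h1.add (tendsto_clm_apply h2 hl)).congr fun j => ?_
    have hxX := hr.dom.iterate_mem (χ j)
    rw [gradLagrangian_eq ((hr.prob.f_bounds.contDiffAt _ hxX).differentiableAt (by norm_num))
      (hr.prob.diff_c _ hxX)]
  have hHL : Tendsto (fun j => hessLagrangian f c (s.x (χ j)) (s.lam (χ j))) atTop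
      (𝓝 (hessLagrangian f c xbar lam)) := by
    refine ((continuousAt_hess hf).tendsto.comp hx).add (tendsto_finsetSum _ fun i _ => ?_)
    have h1 : Tendsto (fun j => s.lam (χ j) i) atTop (𝓝 (lam i)) :=
      ((PiLp.continuous_apply 2 (fun _ : Fin m => ℝ) i).tendsto lam).comp hl
    exact h1.smul ((continuousAt_hess (contDiffAt_con hc i)).tendsto.comp hx)
  refine ⟨lam, ?_, ?_, fun d hd => ?_⟩
  · refine le_of_forall_pos_le_add fun ε hε => ?_
    rw [zero_add]
    exact le_of_tendsto hgL.norm ((hev ε hε).mono fun j hj => hj.1)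
  · refine le_of_forall_pos_le_add fun ε hε => ?_
    rw [zero_add]
    have h1 : Tendsto (fun j => l1 (c (s.x (χ j)))) atTop (𝓝 (l1 (c xbar))) :=
      ((continuous_l1.tendsto _).comp hc.continuousAt.tendsto).comp hx
    exact le_of_tendsto h1 ((hev ε hε).mono fun j hj => hj.2.1)
  · -- A null vector of the limiting Jacobian is the limit of its projections onto the null spaces
    -- along the sequence, because the singular values stay away from zero.
    have h1 : Tendsto (fun j => nullProj (jac c (s.x (χ j))) d) atTop (𝓝 d) := by
      rw [tendsto_iff_norm_sub_tendsto_zero]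
      have h2 : Tendsto (fun j => ‖jac c (s.x (χ j)) d‖ / γ) atTop (𝓝 0) := by
        have := ((tendsto_clm_apply hJ (tendsto_const_nhds (x := d))).norm).div_const γ
        rwa [hd, norm_zero, zero_div] at this
      refine squeeze_zero (fun _ => norm_nonneg _) (fun j => ?_) h2
      rw [norm_sub_rev, le_div_iff₀ hγ, mul_comm]
      exact mul_norm_sub_nullProj_le hγ (hr.adjoint_ge (χ j)) d
    have h3 := h1.inner (𝕜 := ℝ) (tendsto_clm_apply hHL h1)
    have key : ∀ ε, 0 < ε → -ε * ‖d‖ ^ 2 ≤ ⟪d, hessLagrangian f c xbar lam d⟫ := fun ε hε =>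
      le_of_tendsto_of_tendsto ((h1.norm.pow 2).const_mul (-ε)) h3
        ((hev ε hε).mono fun j hj => hj.2.2 _ (apply_nullProj _ _))
    have h4 : Tendsto (fun ε : ℝ => -ε * ‖d‖ ^ 2) (𝓝[>] 0) (𝓝 (-0 * ‖d‖ ^ 2)) :=
      ((continuous_neg.mul continuous_const).tendsto 0).mono_left nhdsWithin_le_nhds
    exact le_of_tendsto h4 (eventually_mem_nhdsWithin.mono fun ε hε => key ε hε)

end BoundedRun

end SCP

theorem mainTheorem5 {n m : ℕ} (p : SCP.Params) (f : Euc n → ℝ) (c : Euc n → Euc m)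
    (s : SCP.Iterates n m) (X : Set (Euc n))
    (hrun : s.IsRun p f c) (hX : s.Domain p f c X)
    (hF1 : SCP.F1 f c X) (hF2 : SCP.F2 c X) (hF3 : s.F3 f c) (hF4 : s.F4 p f c)
    (hF5 : SCP.F5 f c X)
    (Z : ℕ → Euc (n - m) →ₗᵢ[ℝ] Euc n)
    (hZ : ∀ k, LinearMap.range (Z k).toLinearMap =
      LinearMap.ker (SCP.jac c (s.x k) : Euc n →ₗ[ℝ] Euc m)) :
    Tendsto (fun k => ‖SCP.gradLagrangian f c (s.x k) (s.lam k)‖) atTop (𝓝 0) ∧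
    Tendsto (fun k => SCP.l1 (c (s.x k))) atTop (𝓝 0) ∧
    0 ≤ liminf (fun k => SCP.lambdaMin
      (ContinuousLinearMap.adjoint (Z k).toContinuousLinearMap ∘L
        SCP.hessLagrangian f c (s.x k) (s.lam k) ∘L (Z k).toContinuousLinearMap)) atTop ∧
    ∀ xbar : Euc n, MapClusterPt xbar atTop s.x →
      ContDiffAt ℝ 2 f xbar → ContDiffAt ℝ 2 c xbar → SCP.IsSOSP f c 0 0 0 xbar := by
  obtain ⟨K, γ, hb⟩ := SCP.exists_problemBounds hX.isOpen hX.convex hF1 hF2 hF5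
  obtain ⟨κ, hκ, hH⟩ := hF3
  have hr : SCP.BoundedRun p f c s X K γ κ := ⟨hrun, hX, hb, hκ, hH⟩
  have hsq : ∀ a : ℕ → ℝ, (∀ k, 0 ≤ a k) → (∀ ε, 0 < ε → ∀ᶠ k in atTop, a k ≤ ε) →
      Tendsto a atTop (𝓝 0) := fun a ha0 ha => by
    refine tendsto_order.2 ⟨fun b hb => Eventually.of_forall fun k => hb.trans_le (ha0 k),
      fun b hb => (ha (b / 2) (half_pos hb)).mono fun k hk => hk.trans_lt (half_lt_self hb)⟩
  refine ⟨hsq _ (fun _ => norm_nonneg _) fun ε hε =>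
      (hr.eventually_stationary hε).mono fun k hk => hk.1,
    hsq _ (fun _ => SCP.l1_nonneg _) fun ε hε =>
      (hr.eventually_stationary hε).mono fun k hk => hk.2.1,
    le_of_forall_lt fun b hb => ?_, fun xbar => hr.isSOSP_of_mapClusterPt⟩
  obtain ⟨t, hbt, ht0⟩ := EReal.lt_iff_exists_real_btwn.1 hb
  have ht : 0 < -t := neg_pos.2 (EReal.coe_lt_coe_iff.1 ht0)
  refine hbt.trans_le (le_liminf_of_le (by isBoundedDefault) ?_)
  filter_upwards [hr.eventually_stationary ht] with k hk
  refine SCP.le_lambdaMin_of_le_inner fun y => ?_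
  have h1 : SCP.jac c (s.x k) (Z k y) = 0 := by
    have : Z k y ∈ LinearMap.ker (SCP.jac c (s.x k) : Euc n →ₗ[ℝ] Euc m) :=
      hZ k ▸ ⟨y, rfl⟩
    exact LinearMap.mem_ker.1 this
  have h2 := hk.2.2 _ h1
  rw [neg_neg, (Z k).norm_map] at h2
  rw [ContinuousLinearMap.comp_apply, ContinuousLinearMap.adjoint_inner_right]
  exact h2
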